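/- For an integer $N\ge 1$ let $\Omega_{0,N}\subset\mathbf{R}^{2N}$ be the set of all $(a_1,\dots,a_{2N})$ such that the monic real polynomial $P(x)=x^{2N}+a_1x^{2N-1}+\cdots+a_{2N}$ has no real root and all its complex roots have absolute value at most $1$. Let $dV$ be Lebesgue measure on $\mathbf{R}^{2N}$, write $(a)_k=a(a+1)\cdots(a+k-1)$ (with $(a)_0=1$), and set $$K_N=\prod_{k=1}^{N-1}\frac{k!^3\,(k+1)!\,2^{4k+1}}{(2k+1)!^2},\qquad D^{+}_{n}=\prod_{k=0}^{n-1}\frac{2^{k+1}\,k!^2}{(2k+1)!},\qquad D^{-}_{2N}=\frac{2^{2N(N-1)}(2N)!}{N!^2}\,D^{+}_{2N}.$$ Then for every $\alpha\in\mathbf{C}$ with $\mathrm{Re}(\alpha)>-1/2$ the function $|a_{2N}|^{\alpha-1}$ is integrable on $\Omega_{0,N}$, and $$C^{-}_N(\alpha):=\int_{\Omega_{0,N}}|a_{2N}|^{\alpha-1}\,dV=K_N\cdot\binom{2N}{N}\cdot\frac{(4N+2\alpha)\,(N+\alpha+1/2)_N}{(N+\alpha)_{1+N}}\prod_{k=1}^{N}\frac{(\alpha+k)_{2N+1-2k}}{(\alpha-1/2+k)_{2N+2-2k}}.$$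 In particular, $C^{-}_N(1)=\mathrm{Vol}(\Omega_{0,N})=D^{-}_{2N}$. -/

import Mathlib

open MeasureTheory Polynomial

noncomputable section

namespace TotallyComplex

/-- The monic real polynomial `X ^ n + a₁ X ^ (n - 1) + ⋯ + aₙ` attached to a coefficient vector,
where `aₘ` is the entry of index `m - 1`. -/
def monicPoly {n : ℕ} (a : Fin n → ℝ) : ℝ[X] :=
  X ^ n + ∑ i : Fin n, C (a i) * X ^ (i.rev : ℕ)

/-- `Ω_n`: the coefficient vectors of the monic real polynomials of degree `n` all of whose complex
roots have absolute value at most `1`. -/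
def Omega (n : ℕ) : Set (Fin n → ℝ) :=
  {a | ∀ z : ℂ, aeval z (monicPoly a) = 0 → ‖z‖ ≤ 1}

/-- `Ω_{0,N}`: the part of `Ω_{2N}` of the totally complex polynomials, those with no real root
(so their roots form `N` pairs of complex conjugates). -/
def OmegaComplex (N : ℕ) : Set (Fin (2 * N) → ℝ) :=
  {a | a ∈ Omega (2 * N) ∧ ∀ x : ℝ, (monicPoly a).eval x ≠ 0}

/-- The integrand `|a_{2N}| ^ (α - 1)`; here `a_{2N}` is the constant term of the polynomial. -/
def integrand (N : ℕ) (α : ℂ) (a : Fin (2 * N) → ℝ) : ℂ :=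
  ((|(monicPoly a).coeff 0| : ℝ) : ℂ) ^ (α - 1)

/-- `C⁻_N(α)`, the integral of `|a_{2N}| ^ (α - 1)` over `Ω_{0,N}` for Lebesgue measure. -/
def Cminus (N : ℕ) (α : ℂ) : ℂ :=
  ∫ a in OmegaComplex N, integrand N α a

/-- The Pochhammer symbol `(a)_k = a (a + 1) ⋯ (a + k - 1)`. -/
def poch (a : ℂ) (k : ℕ) : ℂ := (ascPochhammer ℂ k).eval a

/-- `K_N = ∏_{k=1}^{N-1} k!³ (k+1)! 2^{4k+1} / (2k+1)!²`. -/
def K (N : ℕ) : ℝ :=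
  ∏ k ∈ Finset.Ico 1 N,
    ((k.factorial : ℝ) ^ 3 * ((k + 1).factorial : ℝ) * 2 ^ (4 * k + 1)) /
      ((2 * k + 1).factorial : ℝ) ^ 2

/-- `D⁺_n = ∏_{k=0}^{n-1} 2^{k+1} k!² / (2k+1)!`. -/
def Dplus (n : ℕ) : ℝ :=
  ∏ k ∈ Finset.range n, (2 ^ (k + 1) * (k.factorial : ℝ) ^ 2) / ((2 * k + 1).factorial : ℝ)

/-- `D⁻_{2N} = 2^{2N(N-1)} (2N)! / N!² · D⁺_{2N}`, as a function of `N`. -/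
def Dminus (N : ℕ) : ℝ :=
  2 ^ (2 * N * (N - 1)) * ((2 * N).factorial : ℝ) / (N.factorial : ℝ) ^ 2 * Dplus (2 * N)

end TotallyComplex

end

/-! A monic real polynomial of degree 2N without real roots amounts to an unordered N-tuple of
points z_j of the upper half plane. In these coordinates Lebesgue measure on the coefficients
becomes 2^N |V| times Lebesgue measure on the z_j, where V is the Vandermonde determinant of the z_j
and their conjugates (`abs_det_fderiv_coeffMap`), and the constant term is ∏ |z_j|².

The decisive point is that |V| = i^N V on the upper half plane (`norm_vander`). The absolute value
disappears, V can be expanded over permutations, and the integral becomes a signed sum of products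
of the moments of z^a conj(z)^b |z|^(2(α-1)) over the half disc, with a ≠ b. Such a moment is 0 if a
and b have the same parity, and 2i / ((a-b)(a+b+2α)) otherwise (`integral_momentFun`). The smallest
a+b is 1, hence the condition Re α > -1/2.

The sum is thus of Pfaffian type with vanishing even-even and odd-odd blocks, so it collapses to the
determinant of the even-odd block (`sum_pairTerm_eq_det`). Since (a-b)(a+b+2α) = (a+α)² - (b+α)²,
this is a Cauchy determinant (`Cminus_eq_cauchyForm`). Its product recursion in N is shared by the
closed form and, at α = 1, by `Dminus`. -/

noncomputable section

namespace TotallyComplex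

/-! ### The Cauchy determinant and its closed form -/

/-- Recursion for the Cauchy determinant, by the Schur complement of the last entry. -/
theorem det_cauchy_succ {F : Type*} [Field F] (x y : ℕ → F) (n : ℕ)
    (h : ∀ i ≤ n, ∀ j ≤ n, y j - x i ≠ 0) :
    (Matrix.of fun i j : Fin (n + 1) => (y j - x i)⁻¹).det =
      (y n - x n)⁻¹ * (∏ i ∈ Finset.range n,
        ((x i - x n) * (y n - y i)) / ((y n - x i) * (y i - x n))) *
        (Matrix.of fun i j : Fin n => (y j - x i)⁻¹).det := by
  classical
  have hn := h n le_rfl n le_rfl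
  rw [← Matrix.det_submatrix_equiv_self (finSumFinEquiv (m := n) (n := 1))]
  have hb : (Matrix.of fun i j : Fin (n + 1) => (y j - x i)⁻¹).submatrix
      (finSumFinEquiv (m := n) (n := 1)) (finSumFinEquiv (m := n) (n := 1)) =
      Matrix.fromBlocks (Matrix.of fun i j : Fin n => (y j - x i)⁻¹)
        (Matrix.of fun (i : Fin n) (_ : Fin 1) => (y n - x i)⁻¹)
        (Matrix.of fun (_ : Fin 1) (j : Fin n) => (y j - x n)⁻¹)
        (Matrix.diagonal fun _ : Fin 1 => (y n - x n)⁻¹) := by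
    ext i j
    rcases i with i | i <;> rcases j with j | j
    · simp
    · simp
    · simp
    · simp [Subsingleton.elim i 0, Subsingleton.elim j 0]
  rw [hb]
  have hu : ∀ _ : Fin 1, IsUnit ((y n - x n)⁻¹) := fun _ => (inv_ne_zero hn).isUnit
  let _ : Invertible (Matrix.diagonal fun _ : Fin 1 => (y n - x n)⁻¹) :=
    ((Matrix.isUnit_diagonal).2 (Pi.isUnit_iff.2 hu)).invertible
  rw [Matrix.det_fromBlocks₂₂]
  -- The rank-one correction turns each entry 1/(y_j - x_i) into itself times a factor of i and a
  -- factor of j: the Schur complement is the smaller Cauchy matrix with rows and columns rescaled.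
  have hs : (Matrix.of fun i j : Fin n => (y j - x i)⁻¹) -
      (Matrix.of fun (i : Fin n) (_ : Fin 1) => (y n - x i)⁻¹) *
        ⅟(Matrix.diagonal fun _ : Fin 1 => (y n - x n)⁻¹) *
        (Matrix.of fun (_ : Fin 1) (j : Fin n) => (y j - x n)⁻¹) =
      Matrix.diagonal (fun i : Fin n => (x i - x n) / (y n - x i)) *
        (Matrix.of fun i j : Fin n => (y j - x i)⁻¹) *
        Matrix.diagonal (fun j : Fin n => (y n - y j) / (y j - x n)) := by
    have hi : ⅟(Matrix.diagonal fun _ : Fin 1 => (y n - x n)⁻¹) =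
        Matrix.diagonal fun _ : Fin 1 => (y n - x n) := by
      apply invOf_eq_right_inv
      rw [Matrix.diagonal_mul_diagonal, ← Matrix.diagonal_one]
      simp [inv_mul_cancel₀ hn]
    rw [hi]
    ext i j
    have h1 := h i i.2.le j j.2.le
    have h2 := h i i.2.le n le_rfl
    have h3 := h n le_rfl j j.2.le
    rw [Matrix.sub_apply, Matrix.mul_diagonal, Matrix.diagonal_mul, Matrix.mul_apply,
      Finset.univ_unique, Finset.sum_singleton, Matrix.mul_diagonal]
    simp only [Matrix.of_apply]
    field_simp
    ring
  rw [hs, Matrix.det_mul, Matrix.det_mul, Matrix.det_diagonal, Matrix.det_diagonal,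
    Matrix.det_diagonal, Finset.prod_range, Finset.univ_unique, Finset.prod_singleton]
  simp only [mul_div_mul_comm, Finset.prod_mul_distrib]
  ring

/-- The part of the recursion ratio free of α. Read backwards it is a partial Wallis product. -/
theorem prod_wallis_reflect (N : ℕ) :
    ∏ i ∈ Finset.range N, ((2 * N - 2 * i) ^ 2 / ((2 * N - 2 * i + 1) * (2 * N - 2 * i - 1)) : ℂ) =
      16 ^ N * (N.factorial : ℂ) ^ 4 / ((2 * N + 1).factorial * (2 * N).factorial) := by
  rw [← Finset.prod_range_reflect]
  have h1 : ∀ i ∈ Finset.range N,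
      ((2 * N - 2 * ((N - 1 - i : ℕ) : ℂ)) ^ 2 /
        ((2 * N - 2 * ((N - 1 - i : ℕ) : ℂ) + 1) * (2 * N - 2 * ((N - 1 - i : ℕ) : ℂ) - 1)) : ℂ) =
      (2 * i + 2) ^ 2 / ((2 * i + 3) * (2 * i + 1)) := by
    intro i hi
    have : (((N - 1 - i : ℕ) : ℂ)) = N - 1 - i := by
      rw [Finset.mem_range] at hi
      rw [Nat.sub_sub, Nat.cast_sub (by omega)]; push_cast; ring
    rw [this]
    congr 1 <;> ring
  rw [Finset.prod_congr rfl h1]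
  clear h1
  induction N with
  | zero => simp
  | succ N ih =>
    rw [Finset.prod_range_succ, ih, show 2 * (N + 1) + 1 = (2 * N + 1) + 1 + 1 by ring,
      show 2 * (N + 1) = 2 * N + 1 + 1 by ring]
    simp only [Nat.factorial_succ, Nat.cast_mul]
    have e1 : ((2 * N + 1 : ℕ) : ℂ) ≠ 0 := Nat.cast_ne_zero.2 (Nat.succ_ne_zero _)
    have e2 : ((2 * N + 1 + 1 : ℕ) : ℂ) ≠ 0 := Nat.cast_ne_zero.2 (Nat.succ_ne_zero _)
    have e3 : ((2 * N + 1 + 1 + 1 : ℕ) : ℂ) ≠ 0 := Nat.cast_ne_zero.2 (Nat.succ_ne_zero _)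
    have e4 : (((2 * N).factorial : ℕ) : ℂ) ≠ 0 := Nat.cast_ne_zero.2 (Nat.factorial_ne_zero _)
    rw [show (2 * (N:ℂ) + 3) = ((2 * N + 1 + 1 + 1 : ℕ) : ℂ) by push_cast; ring,
      show (2 * (N:ℂ) + 1) = ((2 * N + 1 : ℕ) : ℂ) by push_cast; ring,
      show (2 * (N:ℂ) + 2) = ((2 * N + 1 + 1 : ℕ) : ℂ) by push_cast; ring]
    field_simp
    push_cast
    ring

theorem poch_eq_prod (a : ℂ) (k : ℕ) : poch a k = ∏ i ∈ Finset.range k, (a + i) := by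
  unfold poch
  induction k with
  | zero => simp
  | succ k ih => rw [ascPochhammer_succ_right, Finset.prod_range_succ, ← ih]; simp

/-- The closed form of `C⁻_N(α)`. -/
def closedForm (N : ℕ) (α : ℂ) : ℂ :=
  (K N : ℂ) * ((2 * N).choose N : ℂ) *
    ((4 * (N : ℂ) + 2 * α) * poch ((N : ℂ) + α + 1 / 2) N / poch ((N : ℂ) + α) (1 + N)) *
    ∏ k ∈ Finset.Icc 1 N, poch (α + (k : ℂ)) (2 * N + 1 - 2 * k) /
      poch (α - 1 / 2 + (k : ℂ)) (2 * N + 2 - 2 * k)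

/-- `8 ^ N` times the Cauchy determinant of `1 / (y_j - x_i)`, where `x_i = (2 i + α)²` and
`y_j = (2 j + 1 + α)²`. -/
def cauchyForm (N : ℕ) (α : ℂ) : ℂ :=
  8 ^ N * (Matrix.of fun i j : Fin N =>
    ((2 * (j : ℕ) + 1 + α) ^ 2 - (2 * (i : ℕ) + α) ^ 2)⁻¹).det

theorem add_ne_zero_of_re {α : ℂ} (hα : -(1 / 2 : ℝ) < α.re) (c : ℝ) (hc : 1 / 2 ≤ c) :
    α + c ≠ 0 := by
  intro h
  have := congrArg Complex.re h
  simp at this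
  linarith

theorem choose_succ_ratio (N : ℕ) :
    ((2 * (N + 1)).choose (N + 1) : ℂ) =
      ((2 * N).choose N : ℂ) * (2 * (2 * N + 1)) / (N + 1) := by
  have := Nat.succ_mul_centralBinom_succ N
  simp only [Nat.centralBinom] at this
  have h0 : (N + 1 : ℂ) ≠ 0 := by exact_mod_cast Nat.succ_ne_zero N
  rw [eq_div_iff h0]
  have h := congrArg (Nat.cast (R := ℂ)) this
  push_cast at h ⊢
  linear_combination h

theorem K_succ {N : ℕ} (hN : 1 ≤ N) :
    (K (N + 1) : ℂ) = K N * ((N.factorial : ℂ) ^ 3 * ((N + 1).factorial : ℂ) * 2 ^ (4 * N + 1) /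
      ((2 * N + 1).factorial : ℂ) ^ 2) := by
  unfold K
  rw [Finset.prod_Ico_succ_top hN]
  push_cast
  rfl

theorem poch_add_two (a : ℂ) (n : ℕ) : poch a (n + 2) = poch a n * ((a + n) * (a + n + 1)) := by
  simp only [poch_eq_prod, Finset.prod_range_succ]
  push_cast
  ring

/-- Raising N by one appends two factors to every Pochhammer symbol and creates the term k = N + 1.
With k = N - i, the appended factors become shifts of N + α and N + α + 1/2. -/
theorem prod_poch_succ (N : ℕ) (α : ℂ) :
    ∏ k ∈ Finset.Icc 1 (N + 1), poch (α + (k : ℂ)) (2 * (N + 1) + 1 - 2 * k) /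
      poch (α - 1 / 2 + (k : ℂ)) (2 * (N + 1) + 2 - 2 * k) =
    (∏ k ∈ Finset.Icc 1 N, poch (α + (k : ℂ)) (2 * N + 1 - 2 * k) /
      poch (α - 1 / 2 + (k : ℂ)) (2 * N + 2 - 2 * k)) *
    (∏ i ∈ Finset.range N, ((N + α + (i + 1 : ℕ)) * (N + α + (i + 2 : ℕ))) /
      ((N + α + 1 / 2 + (i + 1 : ℕ)) * (N + α + 1 / 2 + (i + 2 : ℕ)))) *
    ((N + α + 1) / ((N + α + 1 / 2) * (N + α + 1 / 2 + 1))) := by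
  rw [Finset.prod_Icc_succ_top (by omega)]
  congr 1
  · have h1 : ∀ k ∈ Finset.Icc 1 N, poch (α + (k : ℂ)) (2 * (N + 1) + 1 - 2 * k) /
        poch (α - 1 / 2 + (k : ℂ)) (2 * (N + 1) + 2 - 2 * k) =
        poch (α + (k : ℂ)) (2 * N + 1 - 2 * k) / poch (α - 1 / 2 + (k : ℂ)) (2 * N + 2 - 2 * k) *
        (((2 * N + α + 1 - k) * (2 * N + α + 2 - k)) /
          ((2 * N + α + 3 / 2 - k) * (2 * N + α + 5 / 2 - k))) := by
      intro k hk
      rw [Finset.mem_Icc] at hk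
      rw [show 2 * (N + 1) + 1 - 2 * k = (2 * N + 1 - 2 * k) + 2 by omega,
        show 2 * (N + 1) + 2 - 2 * k = (2 * N + 2 - 2 * k) + 2 by omega,
        poch_add_two, poch_add_two, Nat.cast_sub (by omega), Nat.cast_sub (by omega),
        mul_div_mul_comm]
      push_cast
      congr 2 <;> ring
    rw [Finset.prod_congr rfl h1, Finset.prod_mul_distrib]
    congr 1
    rw [← Finset.prod_range_reflect, ← Finset.Ico_add_one_right_eq_Icc,
      Finset.prod_Ico_eq_prod_range]
    rw [Nat.add_sub_cancel]
    refine Finset.prod_congr rfl fun i hi => ?_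
    rw [Finset.mem_range] at hi
    have : (((N - 1 - i : ℕ) : ℂ)) = N - 1 - i := by
      rw [Nat.sub_sub, Nat.cast_sub (by omega)]; push_cast; ring
    push_cast
    rw [this]
    congr 1 <;> ring
  · rw [show 2 * (N + 1) + 1 - 2 * (N + 1) = 1 by omega,
      show 2 * (N + 1) + 2 - 2 * (N + 1) = 2 by omega]
    simp only [poch_eq_prod, Finset.prod_range_succ, Finset.prod_range_zero]
    push_cast
    congr 1 <;> ring

theorem prod_range_shift {f : ℕ → ℂ} (N : ℕ) (h0 : f 0 ≠ 0) :
    ∏ i ∈ Finset.range N, f (i + 1) = (∏ i ∈ Finset.range N, f i) * f N / f 0 := by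
  rw [eq_div_iff h0, ← Finset.prod_range_succ, Finset.prod_range_succ']

/-- 4N + 2α is twice the last factor of the Pochhammer symbol in the denominator. -/
theorem closedForm_mid {N : ℕ} {α : ℂ} (h : ∀ i : ℕ, (N : ℂ) + α + i ≠ 0) :
    (4 * (N : ℂ) + 2 * α) * poch ((N : ℂ) + α + 1 / 2) N / poch ((N : ℂ) + α) (1 + N) =
      2 * (∏ i ∈ Finset.range N, ((N : ℂ) + α + 1 / 2 + i)) /
        ∏ i ∈ Finset.range N, ((N : ℂ) + α + i) := by
  rw [poch_eq_prod, poch_eq_prod, add_comm 1 N, Finset.prod_range_succ]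
  have h1 : ∏ i ∈ Finset.range N, ((N : ℂ) + α + i) ≠ 0 := Finset.prod_ne_zero_iff.2 fun i _ => h i
  rw [div_eq_div_iff (mul_ne_zero h1 (h N)) h1]
  ring

theorem closedForm_succ {N : ℕ} (hN : 1 ≤ N) {α : ℂ} (hα : -(1 / 2 : ℝ) < α.re) :
    closedForm (N + 1) α = 8 / (4 * N + 1 + 2 * α) *
      (∏ i ∈ Finset.range N, ((2 * N - 2 * i) ^ 2 / ((2 * N - 2 * i + 1) * (2 * N - 2 * i - 1)) *
        ((N + α + (i + 1 : ℕ)) * (N + α + i) / (N + α + 1 / 2 + i) ^ 2))) * closedForm N α := by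
  have hN' : (1 : ℝ) ≤ N := by exact_mod_cast hN
  have ha : ∀ i : ℕ, (N : ℂ) + α + i ≠ 0 := fun i => by
    have hi : (0 : ℝ) ≤ i := Nat.cast_nonneg i
    have := add_ne_zero_of_re hα (N + i) (by linarith)
    push_cast at this
    convert this using 1; ring
  have hh : ∀ i : ℕ, (N : ℂ) + α + 1 / 2 + i ≠ 0 := fun i => by
    have hi : (0 : ℝ) ≤ i := Nat.cast_nonneg i
    have := add_ne_zero_of_re hα (N + i + 1 / 2) (by linarith)
    push_cast at this
    convert this using 1; ring
  have ha' : ∀ i : ℕ, ((N + 1 : ℕ) : ℂ) + α + i ≠ 0 := fun i => by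
    convert ha (i + 1) using 1; push_cast; ring
  unfold closedForm
  rw [K_succ hN, choose_succ_ratio, closedForm_mid ha, closedForm_mid ha', prod_poch_succ,
    Finset.prod_mul_distrib, prod_wallis_reflect]
  set Q := ∏ k ∈ Finset.Icc 1 N, poch (α + (k : ℂ)) (2 * N + 1 - 2 * k) /
      poch (α - 1 / 2 + (k : ℂ)) (2 * N + 2 - 2 * k)
  have e1 : ∀ i : ℕ, ((N + 1 : ℕ) : ℂ) + α + i = N + α + (i + 1 : ℕ) := fun i => by
    push_cast; ring
  have e2 : ∀ i : ℕ, ((N + 1 : ℕ) : ℂ) + α + 1 / 2 + i = N + α + 1 / 2 + (i + 1 : ℕ) := fun i => by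
    push_cast; ring
  simp only [e1, e2, Finset.prod_div_distrib, Finset.prod_mul_distrib, Finset.prod_pow]
  rw [Finset.prod_range_succ, Finset.prod_range_succ]
  -- Every shifted product is one of the two basic products `A`, `H` up to boundary factors. After
  -- cancellation, a rational identity in those boundary factors remains.
  rw [prod_range_shift (f := fun i => (N : ℂ) + α + (i + 1 : ℕ)) N (ha 1),
    prod_range_shift (f := fun i => (N : ℂ) + α + 1 / 2 + (i + 1 : ℕ)) N (hh 1),
    prod_range_shift (f := fun i => (N : ℂ) + α + i) N (ha 0),
    prod_range_shift (f := fun i => (N : ℂ) + α + 1 / 2 + i) N (hh 0)]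
  have hA : ∏ i ∈ Finset.range N, ((N : ℂ) + α + i) ≠ 0 := Finset.prod_ne_zero_iff.2 fun i _ => ha i
  have hH : ∏ i ∈ Finset.range N, ((N : ℂ) + α + 1 / 2 + i) ≠ 0 :=
    Finset.prod_ne_zero_iff.2 fun i _ => hh i
  set A := ∏ i ∈ Finset.range N, ((N : ℂ) + α + i)
  set H := ∏ i ∈ Finset.range N, ((N : ℂ) + α + 1 / 2 + i)
  have e3 : (4 * N + 1 + 2 * α : ℂ) = 2 * (N + α + 1 / 2 + N) := by ring
  have a0 := ha 0
  have a1 := ha 1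
  have aN := ha N
  have aN1 := ha (N + 1)
  have h0 := hh 0
  have h1 := hh 1
  have hN0 := hh N
  have hN1 := hh (N + 1)
  have e4 : (N : ℂ) + α + 1 = N + α + (1 : ℕ) := by push_cast; ring
  have e5 : (N : ℂ) + α + 1 / 2 + 1 = N + α + 1 / 2 + (1 : ℕ) := by push_cast; ring
  have e6 : (N : ℂ) + α + 1 / 2  = N + α + 1 / 2 + (0 : ℕ) := by push_cast; ring
  rw [e3, e4, e5]
  simp only [zero_add]
  rw [show ((N : ℂ) + α + 1 / 2) * (N + α + 1 / 2 + (1 : ℕ)) =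
    (N + α + 1 / 2 + (0 : ℕ)) * (N + α + 1 / 2 + (1 : ℕ)) by rw [← e6]]
  generalize (N : ℂ) + α + (0 : ℕ) = A0 at *
  generalize (N : ℂ) + α + (1 : ℕ) = A1 at *
  generalize (N : ℂ) + α + N = AN at *
  generalize (N : ℂ) + α + (N + 1 : ℕ) = AN1 at *
  generalize (N : ℂ) + α + 1 / 2 + (0 : ℕ) = H0 at *
  generalize (N : ℂ) + α + 1 / 2 + (1 : ℕ) = H1 at *
  generalize (N : ℂ) + α + 1 / 2 + N = HN at *
  generalize (N : ℂ) + α + 1 / 2 + (N + 1 : ℕ) = HN1 at *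
  rw [Nat.factorial_succ (2 * N), Nat.factorial_succ N]
  have f1 : ((2 * N).factorial : ℂ) ≠ 0 := Nat.cast_ne_zero.2 (Nat.factorial_ne_zero _)
  have f2 : (2 * N + 1 : ℂ) ≠ 0 := by exact_mod_cast Nat.succ_ne_zero (2 * N)
  have f3 : (N + 1 : ℂ) ≠ 0 := by exact_mod_cast Nat.succ_ne_zero N
  push_cast
  rw [show (16 : ℂ) ^ N = 2 ^ (4 * N) by rw [pow_mul]; norm_num]
  field_simp
  ring

/-- Here y_j - x_i = (2j+1-2i)(2j+1+2i+2α): an odd integer times a number of positive real part, so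
no denominator vanishes. -/
theorem cauchyForm_succ (N : ℕ) {α : ℂ} (hα : -(1 / 2 : ℝ) < α.re) :
    cauchyForm (N + 1) α = 8 / (4 * N + 1 + 2 * α) *
      (∏ i ∈ Finset.range N, ((2 * N - 2 * i) ^ 2 / ((2 * N - 2 * i + 1) * (2 * N - 2 * i - 1)) *
        ((N + α + (i + 1 : ℕ)) * (N + α + i) / (N + α + 1 / 2 + i) ^ 2))) * cauchyForm N α := by
  have hodd : ∀ i j : ℕ, (2 * j + 1 - 2 * i : ℂ) ≠ 0 := by
    intro i j h
    have : ((2 * j + 1 - 2 * i : ℤ) : ℂ) = 0 := by push_cast; exact h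
    have := Int.cast_eq_zero.1 this
    omega
  have hh : ∀ i j : ℕ, (2 * j + 1 + 2 * i + 2 * α : ℂ) ≠ 0 := fun i j => by
    have hi : (0 : ℝ) ≤ i := Nat.cast_nonneg i
    have hj : (0 : ℝ) ≤ j := Nat.cast_nonneg j
    have := mul_ne_zero two_ne_zero (add_ne_zero_of_re hα (j + i + 1 / 2) (by linarith))
    push_cast at this
    convert this using 1; ring
  have hfac : ∀ i j : ℕ, (2 * j + 1 + α : ℂ) ^ 2 - (2 * i + α) ^ 2 =
      (2 * j + 1 - 2 * i) * (2 * j + 1 + 2 * i + 2 * α) := fun i j => by ring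
  unfold cauchyForm
  rw [det_cauchy_succ (fun i : ℕ => (2 * i + α : ℂ) ^ 2) (fun j : ℕ => (2 * j + 1 + α : ℂ) ^ 2) N
    (fun i _ j _ => by rw [hfac]; exact mul_ne_zero (hodd i j) (hh i j))]
  have hp : ∀ i ∈ Finset.range N,
      (((2 * i + α : ℂ) ^ 2 - (2 * N + α) ^ 2) * ((2 * N + 1 + α) ^ 2 - (2 * i + 1 + α) ^ 2)) /
        (((2 * N + 1 + α) ^ 2 - (2 * i + α) ^ 2) * ((2 * i + 1 + α) ^ 2 - (2 * N + α) ^ 2)) =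
      ((2 * N - 2 * i) ^ 2 / ((2 * N - 2 * i + 1) * (2 * N - 2 * i - 1)) *
        ((N + α + (i + 1 : ℕ)) * (N + α + i) / (N + α + 1 / 2 + i) ^ 2)) := by
    intro i _
    have n1 := hodd i N
    have n2 := hodd N i
    have n3 := hh i N
    have n4 : (2 * N - 2 * i + 1 : ℂ) ≠ 0 := by convert n1 using 1; ring
    have n5 : (2 * N - 2 * i - 1 : ℂ) ≠ 0 := by
      rw [← neg_ne_zero]; convert n2 using 1; ring
    have n6 : (N + α + 1 / 2 + i : ℂ) ≠ 0 := by
      intro h; apply n3; linear_combination 2 * h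
    rw [hfac, hfac, div_mul_div_comm, div_eq_div_iff
      (mul_ne_zero (mul_ne_zero n1 n3) (mul_ne_zero n2 (by convert n3 using 1; ring)))
      (mul_ne_zero (mul_ne_zero n4 n5) (pow_ne_zero 2 n6))]
    push_cast
    ring
  rw [Finset.prod_congr rfl hp, hfac, pow_succ]
  rw [show (2 * N + 1 - 2 * N : ℂ) * (2 * N + 1 + 2 * N + 2 * α) = 4 * N + 1 + 2 * α by ring]
  ring

/-- Both sides satisfy the same recursion. It has to start at N = 1: for N = 0 and α ≠ 0 the closed
form is 2, while the empty determinant gives 1. -/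
theorem cauchyForm_eq_closedForm {N : ℕ} (hN : 1 ≤ N) {α : ℂ} (hα : -(1 / 2 : ℝ) < α.re) :
    cauchyForm N α = closedForm N α := by
  induction N, hN using Nat.le_induction with
  | base =>
    have h1 := add_ne_zero_of_re hα (1 / 2) le_rfl
    have h2 := add_ne_zero_of_re hα 1 (by norm_num)
    have h3 := add_ne_zero_of_re hα 2 (by norm_num)
    have h4 := add_ne_zero_of_re hα (3 / 2) (by norm_num)
    have h8 : 1 + α ≠ 0 := by convert h2 using 1; push_cast; ring
    have h9 : 1 + α + 1 ≠ 0 := by convert h3 using 1; push_cast; ring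
    have h10 : 2 * α + 1 ≠ 0 := by
      intro h; apply h1; push_cast; linear_combination h / 2
    have h11 : 2 * α + 3 ≠ 0 := by
      intro h; apply h4; push_cast; linear_combination h / 2
    simp only [cauchyForm, closedForm, K, poch_eq_prod, Finset.prod_range_succ,
      Matrix.det_unique, Matrix.of_apply, Finset.Icc_self, Finset.prod_singleton, Finset.Ico_self,
      Finset.prod_empty, Fin.default_eq_zero, Fin.val_zero, Nat.reduceMul, Nat.reduceAdd,
      Nat.reduceSub, Finset.prod_range_zero, Nat.choose_one_right]
    push_cast
    rw [show (2 * 0 + 1 + α) ^ 2 - (2 * 0 + α) ^ 2 = 2 * α + 1 by ring,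
      show 1 + α + 1 / 2 + 0 = (2 * α + 3) / 2 by ring,
      show α - 1 / 2 + 1 + 1 = (2 * α + 3) / 2 by ring,
      show α - 1 / 2 + 1 + 0 = (2 * α + 1) / 2 by ring, show α + 1 + 0 = 1 + α by ring,
      show 1 + α + 0 = 1 + α by ring]
    field_simp
    ring
  | succ N hN ih => rw [cauchyForm_succ N hα, closedForm_succ hN hα, ih]

/-! ### The value at α = 1 -/

theorem prod_odd (n : ℕ) :
    (∏ i ∈ Finset.range n, (2 * i + 1 : ℂ)) * (2 ^ n * n.factorial) = (2 * n).factorial := by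
  induction n with
  | zero => simp
  | succ n ih =>
    rw [Finset.prod_range_succ, show 2 * (n + 1) = 2 * n + 1 + 1 by ring, Nat.factorial_succ,
      Nat.factorial_succ, Nat.factorial_succ]
    push_cast
    rw [← ih]
    ring

/-- Doubling each factor gives the odd numbers from 2N + 3 to 4N + 1, a quotient of two products
treated by `prod_odd`. -/
theorem prod_half_shift (N : ℕ) :
    ∏ i ∈ Finset.range N, (N + 1 + 1 / 2 + i : ℂ) =
      (4 * N + 1).factorial * N.factorial / (4 ^ N * (2 * N).factorial * (2 * N + 1).factorial) := by
  have h1 : ∏ i ∈ Finset.range N, (N + 1 + 1 / 2 + i : ℂ) * 2 =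
      ∏ i ∈ Finset.range N, (2 * ((N + 1 + i : ℕ) : ℂ) + 1) :=
    Finset.prod_congr rfl fun i _ => by push_cast; ring
  rw [Finset.prod_mul_distrib, Finset.prod_const, Finset.card_range] at h1
  have h2 := Finset.prod_range_add (fun i : ℕ => (2 * i + 1 : ℂ)) (N + 1) N
  rw [← h1] at h2
  have h3 := prod_odd (N + 1)
  have h4 := prod_odd (N + 1 + N)
  rw [h2] at h4
  rw [show 2 * (N + 1 + N) = 4 * N + 1 + 1 by ring, Nat.factorial_succ (4 * N + 1),
    show N + 1 + N = 2 * N + 1 by ring] at h4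
  rw [show 2 * (N + 1) = 2 * N + 1 + 1 by ring, Nat.factorial_succ (2 * N + 1),
    Nat.factorial_succ N] at h3
  have f1 : ((2 * N).factorial : ℂ) ≠ 0 := Nat.cast_ne_zero.2 (Nat.factorial_ne_zero _)
  have f2 : ((2 * N + 1).factorial : ℂ) ≠ 0 := Nat.cast_ne_zero.2 (Nat.factorial_ne_zero _)
  have f3 : (N + 1 : ℂ) ≠ 0 := by exact_mod_cast Nat.succ_ne_zero N
  have f4 : (2 * N + 1 : ℂ) ≠ 0 := by exact_mod_cast Nat.succ_ne_zero (2 * N)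
  have f5 : (N.factorial : ℂ) ≠ 0 := Nat.cast_ne_zero.2 (Nat.factorial_ne_zero _)
  set O := ∏ i ∈ Finset.range (N + 1), (2 * i + 1 : ℂ)
  set Q := ∏ i ∈ Finset.range N, (N + 1 + 1 / 2 + i : ℂ)
  have hO : O = (2 * N + 1).factorial / (2 ^ N * N.factorial) := by
    rw [eq_div_iff (mul_ne_zero (pow_ne_zero _ two_ne_zero) f5)]
    refine mul_right_cancel₀ (mul_ne_zero two_ne_zero f3) ?_
    push_cast at h3
    linear_combination h3
  rw [hO] at h4
  rw [eq_div_iff (mul_ne_zero (mul_ne_zero (pow_ne_zero _ (by norm_num)) f1) f2)]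
  have hF : ((2 * N + 1).factorial : ℂ) = (2 * N + 1) * (2 * N).factorial := by
    rw [Nat.factorial_succ]; push_cast; ring
  have hp : (2 : ℂ) ^ N ≠ 0 := pow_ne_zero _ two_ne_zero
  have h4' : Q * (2 * 4 ^ N) * ((2 * N + 1).factorial : ℂ) * (2 * N + 1).factorial =
      (4 * N + 2) * (4 * N + 1).factorial * N.factorial := by
    push_cast at h4
    rw [pow_succ, pow_mul, show (2 : ℂ) ^ 2 = 4 by norm_num] at h4
    field_simp at h4
    linear_combination h4
  refine mul_left_cancel₀ (mul_ne_zero two_ne_zero f4) ?_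
  rw [hF] at h4' ⊢
  linear_combination h4'

theorem prod_add_factorial (a N : ℕ) :
    ∏ i ∈ Finset.range N, ((a + 1 + i : ℕ) : ℂ) = (a + N).factorial / a.factorial := by
  have h := Nat.factorial_mul_ascFactorial a N
  have h5 : (a.factorial : ℂ) ≠ 0 := Nat.cast_ne_zero.2 (Nat.factorial_ne_zero _)
  rw [Nat.ascFactorial_eq_prod_range] at h
  rw [eq_div_iff h5, ← h]
  push_cast
  ring

theorem cauchyForm_one (N : ℕ) : cauchyForm N 1 = (Dminus N : ℂ) := by
  induction N with
  | zero => simp [cauchyForm, Dminus, Dplus]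
  | succ N ih =>
    rw [cauchyForm_succ N (by norm_num), ih, Finset.prod_mul_distrib, prod_wallis_reflect,
      Finset.prod_div_distrib, Finset.prod_mul_distrib, Finset.prod_pow, prod_half_shift]
    have e1 : ∏ i ∈ Finset.range N, ((N : ℂ) + 1 + (i + 1 : ℕ)) =
        (N + 1 + N).factorial / (N + 1).factorial := by
      rw [← prod_add_factorial]
      exact Finset.prod_congr rfl fun i _ => by push_cast; ring
    have e2 : ∏ i ∈ Finset.range N, ((N : ℂ) + 1 + i) = (N + N).factorial / N.factorial := by
      rw [← prod_add_factorial]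
      exact Finset.prod_congr rfl fun i _ => by push_cast; ring
    rw [e1, e2]
    -- The subtraction N - 1 is truncated, so N = 0 is checked apart.
    have e3 : 2 * (N + 1) * (N + 1 - 1) = 2 * N * (N - 1) + 4 * N := by
      cases N with
      | zero => rfl
      | succ n => simp only [Nat.add_sub_cancel]; ring
    unfold Dminus Dplus
    rw [e3, show 2 * (N + 1) = 2 * N + 1 + 1 by ring, Finset.prod_range_succ,
      Finset.prod_range_succ]
    push_cast
    rw [show N + 1 + N = 2 * N + 1 by ring, show N + N = 2 * N by ring,
      show 2 * (2 * N + 1) + 1 = 4 * N + 1 + 1 + 1 by ring, show 2 * (2 * N) + 1 = 4 * N + 1 by ring]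
    simp only [Nat.factorial_succ (2 * N + 1), Nat.factorial_succ (2 * N), Nat.factorial_succ N,
      Nat.factorial_succ (4 * N + 1 + 1), Nat.factorial_succ (4 * N + 1)]
    have f1 : ((2 * N).factorial : ℂ) ≠ 0 := Nat.cast_ne_zero.2 (Nat.factorial_ne_zero _)
    have f2 : ((4 * N + 1).factorial : ℂ) ≠ 0 := Nat.cast_ne_zero.2 (Nat.factorial_ne_zero _)
    have f3 : (N + 1 : ℂ) ≠ 0 := by exact_mod_cast Nat.succ_ne_zero N
    have f4 : (2 * N + 1 : ℂ) ≠ 0 := by exact_mod_cast Nat.succ_ne_zero (2 * N)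
    have f5 : (N.factorial : ℂ) ≠ 0 := Nat.cast_ne_zero.2 (Nat.factorial_ne_zero _)
    have f6 : (4 * N + 1 + 1 : ℂ) ≠ 0 := by exact_mod_cast Nat.succ_ne_zero (4 * N + 1)
    have f7 : (4 * N + 1 + 1 + 1 : ℂ) ≠ 0 := by exact_mod_cast Nat.succ_ne_zero (4 * N + 1 + 1)
    push_cast
    rw [show (4 * N + 1 + 2 * 1 : ℂ) = 4 * N + 1 + 1 + 1 by ring, show (16 : ℂ) = 2 ^ 4 by norm_num,
      show (4 : ℂ) ^ N = (2 ^ N) ^ 2 by rw [← pow_mul, mul_comm, pow_mul]; norm_num]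
    simp only [pow_add, pow_one, pow_mul]
    generalize (∏ x ∈ Finset.range (2 * N), (2 ^ x * 2 * (x.factorial : ℂ) ^ 2) /
      ((2 * x + 1).factorial : ℂ)) = D
    have hp : (2 : ℂ) ^ N ≠ 0 := pow_ne_zero _ two_ne_zero
    rw [show ((2 : ℂ) ^ 4) ^ N = (2 ^ N) ^ 4 by rw [← pow_mul, ← pow_mul, mul_comm],
      show ((2 : ℂ) ^ 2) ^ N = (2 ^ N) ^ 2 by rw [← pow_mul, ← pow_mul, mul_comm]]
    generalize (((2 : ℂ) ^ N) ^ 2) ^ (N - 1) = E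
    generalize (2 : ℂ) ^ N = t at *
    field_simp
    ring

/-! ### Pfaffian-type sums over permutations -/

section Pairing

variable {n R : Type*} [Fintype n] [DecidableEq n] [CommRing R]

open Equiv

/-- The term of the permutation `σ` in the expansion of a Pfaffian-type sum. -/
def pairTerm (A : n ⊕ n → n ⊕ n → R) (σ : Perm (n ⊕ n)) : R :=
  (Perm.sign σ : ℤ) * ∏ j, A (σ (Sum.inl j)) (σ (Sum.inr j))

/-- The swap changes the sign of the permutation, and antisymmetry changes the sign of the j-th
factor. -/
theorem pairTerm_mul_swap {A : n ⊕ n → n ⊕ n → R} (hA : ∀ a b, A a b = -A b a)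
    (σ : Perm (n ⊕ n)) (j : n) :
    pairTerm A (σ * swap (Sum.inl j) (Sum.inr j)) = pairTerm A σ := by
  unfold pairTerm
  rw [Perm.sign_mul, Perm.sign_swap (by simp), ← Finset.mul_prod_erase _ _ (Finset.mem_univ j),
    ← Finset.mul_prod_erase _ (fun j => A (σ (Sum.inl j)) (σ (Sum.inr j))) (Finset.mem_univ j)]
  have : ∏ x ∈ Finset.univ.erase j, A ((σ * swap (Sum.inl j) (Sum.inr j)) (Sum.inl x))
      ((σ * swap (Sum.inl j) (Sum.inr j)) (Sum.inr x)) =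
      ∏ x ∈ Finset.univ.erase j, A (σ (Sum.inl x)) (σ (Sum.inr x)) := by
    refine Finset.prod_congr rfl fun x hx => ?_
    have hx : x ≠ j := Finset.ne_of_mem_erase hx
    rw [Perm.mul_apply, Perm.mul_apply, swap_apply_of_ne_of_ne (by simpa) (by simp),
      swap_apply_of_ne_of_ne (by simp) (by simpa)]
  rw [this, Perm.mul_apply, Perm.mul_apply, swap_apply_left, swap_apply_right,
    hA (σ (Sum.inr j))]
  push_cast
  ring

/-- A nonzero term sends the two members of each pair to opposite halves. The swap at j exchanges
the terms with `σ (inl j)` on the left and those with it on the right, without changing their value,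
so each j in `T` yields a factor 2. -/
theorem sum_pairTerm_eq_two_pow_mul {A : n ⊕ n → n ⊕ n → R} (hA : ∀ a b, A a b = -A b a)
    (hl : ∀ i j, A (Sum.inl i) (Sum.inl j) = 0) (hr : ∀ i j, A (Sum.inr i) (Sum.inr j) = 0)
    (T : Finset n) :
    ∑ σ : Perm (n ⊕ n), pairTerm A σ =
      2 ^ T.card * ∑ σ : Perm (n ⊕ n) with ∀ j ∈ T, (σ (Sum.inl j)).isLeft, pairTerm A σ := by
  induction T using Finset.induction_on with
  | empty => simp
  | insert j T hj ih =>
    rw [ih, Finset.card_insert_of_notMem hj, pow_succ, mul_assoc]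
    congr 1
    have hz : ∀ σ : Perm (n ⊕ n), (σ (Sum.inl j)).isLeft = (σ (Sum.inr j)).isLeft →
        pairTerm A σ = 0 := by
      intro σ h
      unfold pairTerm
      rw [Finset.prod_eq_zero (Finset.mem_univ j), mul_zero]
      rcases h1 : σ (Sum.inl j) with a | a <;> rcases h2 : σ (Sum.inr j) with b | b <;>
        simp_all
    have hT : ∀ σ : Perm (n ⊕ n), (∀ i ∈ T, ((σ * swap (Sum.inl j) (Sum.inr j)) (Sum.inl i)).isLeft)
        ↔ ∀ i ∈ T, (σ (Sum.inl i)).isLeft := by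
      intro σ
      refine forall₂_congr fun i hi => ?_
      have : i ≠ j := fun h => hj (h ▸ hi)
      rw [Perm.mul_apply, swap_apply_of_ne_of_ne (by simpa) (by simp)]
    have h1 : ∑ σ : Perm (n ⊕ n) with ∀ j ∈ T, (σ (Sum.inl j)).isLeft, pairTerm A σ =
        ∑ σ : Perm (n ⊕ n) with (∀ j ∈ T, (σ (Sum.inl j)).isLeft) ∧ (σ (Sum.inl j)).isLeft,
          pairTerm A σ +
        ∑ σ : Perm (n ⊕ n) with (∀ j ∈ T, (σ (Sum.inl j)).isLeft) ∧ ¬ (σ (Sum.inl j)).isLeft,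
          pairTerm A σ := by
      rw [← Finset.filter_filter, ← Finset.filter_filter, Finset.sum_filter_add_sum_filter_not]
    have h2 : ∑ σ : Perm (n ⊕ n) with
          (∀ j ∈ T, (σ (Sum.inl j)).isLeft) ∧ ¬ (σ (Sum.inl j)).isLeft, pairTerm A σ =
        ∑ σ : Perm (n ⊕ n) with (∀ j ∈ T, (σ (Sum.inl j)).isLeft) ∧ (σ (Sum.inl j)).isLeft,
          pairTerm A σ := by
      rw [Finset.sum_filter, Finset.sum_filter,
        ← Equiv.sum_comp (Equiv.mulRight (swap (Sum.inl j) (Sum.inr j)))]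
      refine Finset.sum_congr rfl fun σ _ => ?_
      simp only [Equiv.coe_mulRight, hT, pairTerm_mul_swap hA]
      rw [Perm.mul_apply, swap_apply_left]
      by_cases h : (σ (Sum.inl j)).isLeft = (σ (Sum.inr j)).isLeft
      · simp [hz σ h]
      · have : ¬ ((σ (Sum.inr j)).isLeft = true) ↔ (σ (Sum.inl j)).isLeft = true := by
          revert h
          cases (σ (Sum.inl j)).isLeft <;> cases (σ (Sum.inr j)).isLeft <;> simp
        simp only [this]
    have h3 : (Finset.univ.filter fun σ : Perm (n ⊕ n) =>
        (∀ j ∈ T, (σ (Sum.inl j)).isLeft) ∧ (σ (Sum.inl j)).isLeft) =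
        Finset.univ.filter fun σ : Perm (n ⊕ n) =>
          ∀ i ∈ insert j T, (σ (Sum.inl i)).isLeft := by
      ext σ
      simp [and_comm]
    rw [h1, h2, h3, two_mul]

/-- A permutation mapping the left half into itself preserves both halves, hence is a pair (τ, τ').
For fixed τ the sum over τ' is the determinant with its rows permuted by τ, corrected by the sign of
τ, so all τ contribute equally. -/
theorem sum_sumCongr_pairTerm (A : n ⊕ n → n ⊕ n → R) :
    ∑ σ : Perm (n ⊕ n) with ∀ j ∈ Finset.univ, (σ (Sum.inl j)).isLeft, pairTerm A σ =
      (Fintype.card n).factorial * (Matrix.of fun i j => A (Sum.inl i) (Sum.inr j)).det := by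
  have h1 : ∑ σ : Perm (n ⊕ n) with ∀ j ∈ Finset.univ, (σ (Sum.inl j)).isLeft, pairTerm A σ =
      ∑ τ : Perm n × Perm n, pairTerm A (Perm.sumCongrHom n n τ) := by
    symm
    refine Finset.sum_of_injOn (Perm.sumCongrHom n n) Perm.sumCongrHom_injective.injOn ?_ ?_ ?_
    · intro τ _
      simp
    · intro σ hσ hσ'
      exfalso
      apply hσ'
      simp only [Finset.mem_filter, Finset.mem_univ, true_and, forall_const] at hσ
      have : Set.MapsTo σ (Set.range Sum.inl) (Set.range Sum.inl) := by
        rintro _ ⟨j, rfl⟩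
        obtain ⟨y, hy⟩ := Sum.isLeft_iff.1 (hσ j)
        exact ⟨y, hy.symm⟩
      obtain ⟨τ, rfl⟩ := Perm.mem_sumCongrHom_range_of_perm_mapsTo_inl this
      exact ⟨τ, by simp, rfl⟩
    · intros; rfl
  rw [h1, Fintype.sum_prod_type]
  have h2 : ∀ τ : Perm n, ∑ τ' : Perm n, pairTerm A (Perm.sumCongrHom n n (τ, τ')) =
      (Matrix.of fun i j => A (Sum.inl i) (Sum.inr j)).det := by
    intro τ
    have hs : ((Perm.sign τ : ℤ) : R) * (Perm.sign τ : ℤ) = 1 := by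
      rw [← Int.cast_mul, ← Units.val_mul, Int.units_mul_self]; simp
    have hd := Matrix.det_permute τ (Matrix.of fun i j => A (Sum.inl i) (Sum.inr j))
    have hd2 : (Matrix.of fun i j => A (Sum.inl i) (Sum.inr j)).det =
        (Perm.sign τ : ℤ) *
          ((Matrix.of fun i j => A (Sum.inl i) (Sum.inr j)).submatrix τ id).det := by
      rw [hd, ← mul_assoc, hs, one_mul]
    rw [hd2, ← Matrix.det_transpose, Matrix.det_apply', Finset.mul_sum]
    refine Finset.sum_congr rfl fun τ' _ => ?_
    simp [pairTerm, Perm.sign_sumCongr, mul_assoc]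
  simp only [h2, Finset.sum_const, Finset.card_univ, Fintype.card_perm, nsmul_eq_mul]

theorem sum_pairTerm_eq_det {A : n ⊕ n → n ⊕ n → R} (hA : ∀ a b, A a b = -A b a)
    (hl : ∀ i j, A (Sum.inl i) (Sum.inl j) = 0) (hr : ∀ i j, A (Sum.inr i) (Sum.inr j) = 0) :
    ∑ σ : Perm (n ⊕ n), pairTerm A σ =
      2 ^ Fintype.card n * ((Fintype.card n).factorial *
        (Matrix.of fun i j => A (Sum.inl i) (Sum.inr j)).det) := by
  rw [sum_pairTerm_eq_two_pow_mul hA hl hr Finset.univ, sum_sumCongr_pairTerm, Finset.card_univ]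

end Pairing

/-! ### Moments of the half disc -/

open Real ComplexConjugate

/-- The upper half of the closed unit disc. -/
def halfDisc : Set ℂ := {z | 0 < z.im ∧ ‖z‖ ≤ 1}

theorem measurableSet_halfDisc : MeasurableSet halfDisc :=
  (measurableSet_lt measurable_const Complex.measurable_im).inter
    (measurableSet_le measurable_norm measurable_const)

/-- The weighted monomial `z ^ a * conj z ^ b * |z| ^ (2 (α - 1))`. -/
def momentFun (α : ℂ) (a b : ℕ) (z : ℂ) : ℂ :=
  z ^ a * conj z ^ b * ((‖z‖ ^ 2 : ℝ) : ℂ) ^ (α - 1)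

/-- The closed form of the integral of `momentFun α a b` over `halfDisc`, for `a ≠ b`. -/
def moment (α : ℂ) (a b : ℕ) : ℂ :=
  if Even (a + b) then 0 else 2 * Complex.I / (((a : ℂ) - b) * (a + b + 2 * α))

/-- In polar coordinates the norm, with the area factor, is r^(a+b+2 Re α-1). Its exponent exceeds
-1 because a + b ≥ 1 and Re α > -1/2. -/
theorem integrableOn_momentFun {α : ℂ} (hα : -(1 / 2 : ℝ) < α.re) {a b : ℕ} (hab : 1 ≤ a + b) :
    IntegrableOn (momentFun α a b) halfDisc := by
  set s : ℝ := a + b + 2 * (α.re - 1) with hs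
  have hab' : (1 : ℝ) ≤ a + b := by exact_mod_cast hab
  have hr : Integrable (fun z : ℂ => (Set.Ioc (0 : ℝ) 1).indicator (fun r => r ^ s) ‖z‖) := by
    rw [integrable_fun_norm_addHaar volume
      (f := (Set.Ioc (0 : ℝ) 1).indicator (fun r => r ^ s))]
    have h1 : IntegrableOn (fun r : ℝ => r ^ (s + 1)) (Set.Ioc 0 1) := by
      rw [← intervalIntegrable_iff_integrableOn_Ioc_of_le zero_le_one]
      exact intervalIntegral.intervalIntegrable_rpow' (by linarith)
    have h2 := (h1.integrable_indicator measurableSet_Ioc).integrableOn (s := Set.Ioi 0)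
    refine h2.congr_fun (fun y hy => ?_) measurableSet_Ioi
    have hy : 0 < y := hy
    simp only [Complex.finrank_real_complex, Set.indicator_apply]
    split_ifs
    · rw [Real.rpow_add_one hy.ne', smul_eq_mul]; ring
    · simp
  refine Integrable.mono' hr.integrableOn ?_ ?_
  · apply Measurable.aestronglyMeasurable
    unfold momentFun
    fun_prop
  · refine (ae_restrict_iff' measurableSet_halfDisc).2 (Filter.Eventually.of_forall fun z hz => ?_)
    have hz0 : 0 < ‖z‖ := norm_pos_iff.2 fun h => by simp [h, halfDisc] at hz
    rw [Set.indicator_of_mem (show ‖z‖ ∈ Set.Ioc (0 : ℝ) 1 from ⟨hz0, hz.2⟩), momentFun, norm_mul, norm_mul, norm_pow, norm_pow,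
      RCLike.norm_conj, Complex.norm_cpow_eq_rpow_re_of_pos (by positivity), hs, rpow_add hz0,
      rpow_add hz0, rpow_natCast, rpow_natCast, ← rpow_natCast ‖z‖ 2, ← rpow_mul hz0.le]
    simp

theorem integral_momentFun_eq_polar (α : ℂ) (a b : ℕ) :
    ∫ z in halfDisc, momentFun α a b z =
      ∫ p in Set.Ioc (0 : ℝ) 1 ×ˢ Set.Ioo 0 π,
        (p.1 : ℂ) ^ ((a : ℂ) + b + 2 * α - 1) * Complex.exp ((((a : ℂ) - b) * Complex.I) * p.2) := by
  rw [← integral_indicator measurableSet_halfDisc, ← Complex.integral_comp_polarCoord_symm,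
    ← integral_indicator (measurableSet_Ioc.prod measurableSet_Ioo),
    ← integral_indicator polarCoord.open_target.measurableSet]
  congr 1
  ext ⟨r, θ⟩
  by_cases ht : (r, θ) ∈ polarCoord.target
  · rw [Set.indicator_of_mem ht]
    obtain ⟨hr, hθ1, hθ2⟩ := ht
    have hr : 0 < r := hr
    have him : (Complex.polarCoord.symm (r, θ)).im = r * Real.sin θ := by
      simp [Complex.cos_ofReal_re, Complex.sin_ofReal_re]
    have hmem : Complex.polarCoord.symm (r, θ) ∈ halfDisc ↔
        (r, θ) ∈ Set.Ioc (0 : ℝ) 1 ×ˢ Set.Ioo 0 π := by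
      simp only [halfDisc, Set.mem_ofPred_eq, him, Complex.norm_polarCoord_symm, Set.mem_prod,
        Set.mem_Ioc, Set.mem_Ioo, abs_of_pos hr, hr, true_and, mul_pos_iff_of_pos_left, hθ2, and_true]
      rw [and_comm]
      refine and_congr_right fun _ => ⟨fun h => ?_, fun h => sin_pos_of_pos_of_lt_pi h hθ2⟩
      by_contra h0
      exact absurd h (not_lt.2 (sin_nonpos_of_nonpos_of_neg_pi_le (not_lt.1 h0) hθ1.le))
    by_cases hm : (r, θ) ∈ Set.Ioc (0 : ℝ) 1 ×ˢ Set.Ioo 0 π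
    · rw [Set.indicator_of_mem (hmem.2 hm), Set.indicator_of_mem hm]
      have hz : Complex.polarCoord.symm (r, θ) = r * Complex.exp (θ * Complex.I) := by
        rw [Complex.polarCoord_symm_apply, Complex.exp_mul_I]; simp
      have hrc : (r : ℂ) ≠ 0 := by exact_mod_cast hr.ne'
      rw [momentFun, Complex.norm_polarCoord_symm, hz, map_mul, Complex.conj_ofReal,
        ← Complex.exp_conj, map_mul, Complex.conj_I, Complex.conj_ofReal, mul_pow, mul_pow,
        ← Complex.exp_nat_mul, ← Complex.exp_nat_mul]
      simp only [abs_of_pos hr]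
      have h2 : (((r ^ 2 : ℝ)) : ℂ) ^ (α - 1) = (r : ℂ) ^ (2 * (α - 1)) := by
        rw [pow_two, Complex.ofReal_mul, Complex.mul_cpow_ofReal_nonneg hr.le hr.le,
          ← Complex.cpow_add _ _ hrc]
        ring_nf
      rw [h2, show (a : ℂ) + b + 2 * α - 1 = a + b + 2 * (α - 1) + 1 by ring,
        Complex.cpow_add _ _ hrc, Complex.cpow_add _ _ hrc, Complex.cpow_add _ _ hrc,
        Complex.cpow_natCast, Complex.cpow_natCast, Complex.cpow_one,
        show ((a : ℂ) - b) * Complex.I * θ = a * (θ * Complex.I) + b * (θ * -Complex.I) by ring,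
        Complex.exp_add, Complex.real_smul]
      ring
    · rw [Set.indicator_of_notMem (fun h => hm (hmem.1 h)), Set.indicator_of_notMem hm, smul_zero]
  · rw [Set.indicator_of_notMem ht, Set.indicator_of_notMem]
    rintro ⟨h1, h2⟩
    exact ht ⟨h1.1, (neg_lt_zero.2 pi_pos).trans h2.1, h2.2⟩

/-- The radial integral is 1/(a+b+2α). The angular one is ((-1)^(a+b) - 1)/(i(a-b)), and this is
where the dependence on parity comes from. -/
theorem integral_momentFun {α : ℂ} (hα : -(1 / 2 : ℝ) < α.re) {a b : ℕ} (hab : a ≠ b) :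
    ∫ z in halfDisc, momentFun α a b z = moment α a b := by
  have hab1 : 1 ≤ a + b := by omega
  have hab' : (1 : ℝ) ≤ a + b := by exact_mod_cast hab1
  have hc : ((a : ℂ) - b) ≠ 0 := sub_ne_zero.2 (by exact_mod_cast hab)
  have hd : ((a : ℂ) + b + 2 * α) ≠ 0 := by
    intro h
    have := congrArg Complex.re h
    simp at this
    linarith
  rw [integral_momentFun_eq_polar, Measure.volume_eq_prod, 
    setIntegral_prod_mul (fun r : ℝ => (r : ℂ) ^ ((a : ℂ) + b + 2 * α - 1))
      (fun θ : ℝ => Complex.exp ((((a : ℂ) - b) * Complex.I) * θ)),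
    ← intervalIntegral.integral_of_le zero_le_one, ← integral_Ioc_eq_integral_Ioo,
    ← intervalIntegral.integral_of_le pi_pos.le, integral_cpow (Or.inl (by simp; linarith)),
    integral_exp_mul_complex (mul_ne_zero hc Complex.I_ne_zero)]
  have h1 : (a : ℂ) + b + 2 * α - 1 + 1 = a + b + 2 * α := by ring
  have he : Complex.exp (((a : ℂ) - b) * Complex.I * π) = (-1) ^ (a + b) := by
    rw [show ((a : ℂ) - b) * Complex.I * π = a * (π * Complex.I) - b * (π * Complex.I) by ring,
      Complex.exp_sub, Complex.exp_nat_mul, Complex.exp_nat_mul, Complex.exp_pi_mul_I, pow_add,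
      div_eq_mul_inv, ← inv_pow]
    norm_num
  rw [h1, he]
  simp only [Complex.ofReal_one, Complex.one_cpow, Complex.ofReal_zero, Complex.zero_cpow hd,
    mul_zero, Complex.exp_zero, sub_zero]
  unfold moment
  split_ifs with h
  · simp [h.neg_one_pow]
  · rw [(Nat.not_even_iff_odd.1 h).neg_one_pow]
    have := Complex.I_ne_zero
    field_simp
    rw [Complex.I_sq]
    ring

/-- This includes a = b, where `moment` is 0 by convention and need not be the integral; only
distinct exponents occur later. -/
theorem moment_antisymm (α : ℂ) (a b : ℕ) : moment α a b = -moment α b a := by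
  unfold moment
  rw [add_comm b a]
  split_ifs
  · simp
  · rw [← div_neg]
    congr 1
    ring

/-! ### Roots and coefficients -/

variable {N : ℕ}

/-- The exponent attached to an index: the even numbers, followed by the odd ones. -/
def expo : Fin N ⊕ Fin N → ℕ := Sum.elim (fun j => 2 * j) (fun j => 2 * j + 1)

theorem expo_lt (k : Fin N ⊕ Fin N) : expo k < 2 * N := by
  rcases k with j | j <;> simp only [expo, Sum.elim_inl, Sum.elim_inr] <;> omega

theorem expo_injective : Function.Injective (expo (N := N)) := by
  rintro (i | i) (j | j) h <;> simp only [expo, Sum.elim_inl, Sum.elim_inr] at h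
  · congr; ext; omega
  · omega
  · omega
  · congr; ext; omega

variable (N) in
/-- The numbering of the indices by their exponents. -/
def pairEquiv : Fin N ⊕ Fin N ≃ Fin (2 * N) :=
  Equiv.ofBijective (fun k => ⟨expo k, expo_lt k⟩) <|
    (Fintype.bijective_iff_injective_and_card _).2
      ⟨fun _ _ h => expo_injective (Fin.mk.inj h), by simp [two_mul]⟩

@[simp]
theorem pairEquiv_val (k : Fin N ⊕ Fin N) : (pairEquiv N k : ℕ) = expo k := rfl

/-- The roots `z_j` and their conjugates. -/
def rootVec (z : Fin N → ℂ) : Fin N ⊕ Fin N → ℂ := Sum.elim z fun j => conj (z j)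

/-- The complex numbers with given real and imaginary parts. -/
def toRoots (N : ℕ) : (Fin N ⊕ Fin N → ℝ) →L[ℝ] (Fin N → ℂ) :=
  ContinuousLinearMap.pi fun j =>
    Complex.ofRealCLM.comp (ContinuousLinearMap.proj (Sum.inl j)) +
      Complex.I • Complex.ofRealCLM.comp (ContinuousLinearMap.proj (Sum.inr j))

theorem toRoots_apply (x : Fin N ⊕ Fin N → ℝ) (j : Fin N) :
    toRoots N x j = x (Sum.inl j) + Complex.I * x (Sum.inr j) := by
  simp [toRoots]

/-- The roots and their conjugates as linear functions of the real and imaginary parts. -/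
def rootCLM : Fin N ⊕ Fin N → ((Fin N ⊕ Fin N → ℝ) →L[ℝ] ℂ) :=
  Sum.elim (fun j => (ContinuousLinearMap.proj j).comp (toRoots N))
    fun j => (Complex.conjCLE : ℂ →L[ℝ] ℂ).comp ((ContinuousLinearMap.proj j).comp (toRoots N))

theorem rootCLM_apply (k : Fin N ⊕ Fin N) (x : Fin N ⊕ Fin N → ℝ) :
    rootCLM k x = rootVec (toRoots N x) k := by
  rcases k with j | j <;> simp [rootCLM, rootVec]

theorem measurePreserving_toRoots (N : ℕ) : MeasurePreserving (toRoots N) := by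
  have h1 := volume_measurePreserving_sumPiEquivProdPi (fun _ : Fin N ⊕ Fin N => ℝ)
  have h2 := (volume_measurePreserving_arrowProdEquivProdArrow ℝ ℝ (Fin N)).symm
  have h3 : MeasurePreserving
      (fun (p : Fin N → ℝ × ℝ) (j : Fin N) => Complex.measurableEquivRealProd.symm (p j)) :=
    volume_preserving_pi fun _ => Complex.volume_preserving_equiv_real_prod.symm
  have h4 := h3.comp (h2.comp h1)
  have heq : ⇑(toRoots N) = (fun (p : Fin N → ℝ × ℝ) (j : Fin N) =>
      Complex.measurableEquivRealProd.symm (p j)) ∘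
      (MeasurableEquiv.arrowProdEquivProdArrow ℝ ℝ (Fin N)).symm ∘
      (MeasurableEquiv.sumPiEquivProdPi fun _ : Fin N ⊕ Fin N => ℝ) := by
    ext x j
    rw [toRoots_apply]
    apply Complex.ext
    · simp; rfl
    · simp; rfl
  rw [heq]
  exact h4

theorem toRoots_bijective (N : ℕ) : Function.Bijective (toRoots N) := by
  constructor
  · intro x y h
    ext k
    rcases k with j | j
    · simpa [toRoots_apply] using congrArg Complex.re (congrFun h j)
    · simpa [toRoots_apply] using congrArg Complex.im (congrFun h j)
  · intro z
    refine ⟨Sum.elim (fun j => (z j).re) fun j => (z j).im, funext fun j => ?_⟩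
    rw [toRoots_apply]
    apply Complex.ext <;> simp

theorem measurableEmbedding_toRoots (N : ℕ) : MeasurableEmbedding (toRoots N) :=
  (toRoots N).continuous.measurableEmbedding (toRoots_bijective N).1

/-- The real polynomial with roots `z_j` and `conj z_j`. -/
def rootPoly (z : Fin N → ℂ) : ℝ[X] :=
  ∏ j, (X ^ 2 - C (2 * (z j).re) * X + C (Complex.normSq (z j)))

theorem quad_map (w : ℂ) :
    (X ^ 2 - C (2 * w.re) * X + C (Complex.normSq w) : ℝ[X]).map (algebraMap ℝ ℂ) =
      (X - C w) * (X - C (conj w)) := by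
  have h1 : ((2 * w.re : ℝ) : ℂ) = w + conj w := (Complex.add_conj w).symm ▸ by simp
  have h2 : ((Complex.normSq w : ℝ) : ℂ) = w * conj w := (Complex.mul_conj w).symm
  simp only [Polynomial.map_add, Polynomial.map_sub, Polynomial.map_mul, Polynomial.map_pow, map_X,
    map_C, Complex.coe_algebraMap]
  rw [h1, h2, C_add, C_mul]
  ring

theorem rootPoly_map (z : Fin N → ℂ) :
    (rootPoly z).map (algebraMap ℝ ℂ) = ∏ k, (X - C (rootVec z k)) := by
  rw [rootPoly, Polynomial.map_prod, Fintype.prod_sum_type, ← Finset.prod_mul_distrib]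
  exact Finset.prod_congr rfl fun j _ => quad_map _

theorem rootPoly_monic (z : Fin N → ℂ) : (rootPoly z).Monic := by
  apply Polynomial.monic_of_injective (algebraMap ℝ ℂ).injective
  rw [rootPoly_map]
  exact monic_prod_of_monic _ _ fun k _ => monic_X_sub_C _

theorem rootPoly_natDegree (z : Fin N → ℂ) : (rootPoly z).natDegree = 2 * N := by
  rw [← natDegree_map_eq_of_injective (algebraMap ℝ ℂ).injective, rootPoly_map,
    natDegree_prod_of_monic _ _ fun k _ => monic_X_sub_C _]
  simp [two_mul]

theorem aeval_rootPoly (z : Fin N → ℂ) (t : ℂ) :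
    aeval t (rootPoly z) = ∏ k, (t - rootVec z k) := by
  rw [aeval_def, ← eval_map, rootPoly_map, eval_prod]
  simp

theorem monicPoly_coeff {n : ℕ} (a : Fin n → ℝ) (i : Fin n) :
    (monicPoly a).coeff (i.rev : ℕ) = a i := by
  unfold monicPoly
  rw [coeff_add, coeff_X_pow, if_neg (by omega), zero_add, finsetSum_coeff]
  simp only [coeff_C_mul, coeff_X_pow]
  rw [Finset.sum_eq_single i]
  · simp
  · intro j _ hj
    rw [if_neg, mul_zero]
    intro h
    exact hj (Fin.rev_injective (Fin.ext h)).symm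
  · simp

theorem monicPoly_of_monic {n : ℕ} {p : ℝ[X]} (hp : p.Monic) (hn : p.natDegree = n) :
    monicPoly (fun i : Fin n => p.coeff (i.rev : ℕ)) = p := by
  conv_rhs => rw [hp.as_sum, hn, Finset.sum_range]
  unfold monicPoly
  congr 1
  exact Equiv.sum_comp Fin.revPerm (fun i : Fin n => C (p.coeff i) * X ^ (i : ℕ))

variable (N) in
/-- The reordering of the coefficients by `expo`. -/
def coeffEquiv : (Fin N ⊕ Fin N → ℝ) ≃ᵐ (Fin (2 * N) → ℝ) :=
  MeasurableEquiv.piCongrLeft (fun _ => ℝ) ((pairEquiv N).trans Fin.revPerm)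

theorem coeffEquiv_apply (b : Fin N ⊕ Fin N → ℝ) (k : Fin N ⊕ Fin N) :
    coeffEquiv N b (pairEquiv N k).rev = b k :=
  Equiv.piCongrLeft_apply_apply (fun _ => ℝ) ((pairEquiv N).trans Fin.revPerm) b k

theorem measurePreserving_coeffEquiv (N : ℕ) : MeasurePreserving (coeffEquiv N) :=
  volume_measurePreserving_piCongrLeft (fun _ => ℝ) _

/-- The coefficients, other than the leading one, of the polynomial with given roots. -/
def coeffMap (z : Fin N → ℂ) : Fin N ⊕ Fin N → ℝ := fun k => (rootPoly z).coeff (expo k)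

theorem coeffEquiv_eq_iff {b : Fin N ⊕ Fin N → ℝ} {a : Fin (2 * N) → ℝ} :
    coeffEquiv N b = a ↔ ∀ k, (monicPoly a).coeff (expo k) = b k := by
  have h (k : Fin N ⊕ Fin N) : (monicPoly a).coeff (expo k) = a (pairEquiv N k).rev := by
    rw [← monicPoly_coeff a, Fin.rev_rev, pairEquiv_val]
  constructor
  · rintro rfl k
    rw [h, coeffEquiv_apply]
  · intro hb
    ext i
    obtain ⟨k, rfl⟩ : ∃ k, (pairEquiv N k).rev = i :=
      ⟨(pairEquiv N).symm i.rev, by simp⟩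
    rw [coeffEquiv_apply, ← hb, h]

theorem monicPoly_coeffMap (z : Fin N → ℂ) : monicPoly (coeffEquiv N (coeffMap z)) = rootPoly z := by
  have h := monicPoly_of_monic (rootPoly_monic z) (rootPoly_natDegree z)
  have h2 : coeffEquiv N (coeffMap z) = fun i => (rootPoly z).coeff (i.rev : ℕ) :=
    coeffEquiv_eq_iff.2 fun k => by rw [h]; rfl
  rw [h2, h]

theorem coeffMap_of_monicPoly {b : Fin N ⊕ Fin N → ℝ} {z : Fin N → ℂ}
    (h : monicPoly (coeffEquiv N b) = rootPoly z) : b = coeffMap z := by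
  ext k
  rw [← (coeffEquiv_eq_iff (b := b)).1 rfl k, h, coeffMap]

/-! ### The Jacobian of the coefficient map -/

theorem differentiable_coeff_prod {E ι : Type*} [NormedAddCommGroup E] [NormedSpace ℝ E]
    (s : Finset ι) (p : ι → E → ℝ[X]) (hp : ∀ i m, Differentiable ℝ fun x => (p i x).coeff m)
    (m : ℕ) : Differentiable ℝ fun x => (∏ i ∈ s, p i x).coeff m := by
  classical
  induction s using Finset.induction_on generalizing m with
  | empty => simp
  | insert i s hi ih =>
    simp only [Finset.prod_insert hi, coeff_mul]
    exact Differentiable.fun_sum fun q _ => (hp i q.1).mul (ih q.2)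

theorem differentiable_coeffMap (N : ℕ) :
    Differentiable ℝ fun x : Fin N ⊕ Fin N → ℝ => coeffMap (toRoots N x) := by
  rw [differentiable_pi]
  intro k
  refine differentiable_coeff_prod _ (fun j x => X ^ 2 - C (2 * (toRoots N x j).re) * X +
    C (Complex.normSq (toRoots N x j))) (fun j m => ?_) _
  have h1 : ∀ x : Fin N ⊕ Fin N → ℝ, (toRoots N x j).re = x (Sum.inl j) := fun x => by
    simp [toRoots_apply]
  have h2 : ∀ x : Fin N ⊕ Fin N → ℝ, (toRoots N x j).im = x (Sum.inr j) := fun x => by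
    simp [toRoots_apply]
  simp only [coeff_add, coeff_sub, coeff_C_mul, coeff_X, coeff_X_pow, coeff_C, Complex.normSq_apply,
    h1, h2]
  split_ifs <;> fun_prop

/-- The Vandermonde determinant of the roots `z_j`, `conj z_j`. -/
def vander (z : Fin N → ℂ) : ℂ :=
  (Matrix.of fun m k : Fin N ⊕ Fin N => rootVec z m ^ expo k).det

theorem vander_eq_det_vandermonde (z : Fin N → ℂ) :
    vander z = (Matrix.vandermonde fun i => rootVec z ((pairEquiv N).symm i)).det := by
  rw [← Matrix.det_submatrix_equiv_self (pairEquiv N), vander]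
  congr 1
  ext m k
  simp [Matrix.vandermonde_apply]

theorem aeval_rootPoly_eq_sum (z : Fin N → ℂ) (t : ℂ) :
    aeval t (rootPoly z) = t ^ (2 * N) + ∑ k, t ^ expo k * (coeffMap z k : ℂ) := by
  rw [(rootPoly_monic z).as_sum, rootPoly_natDegree, Finset.sum_range,
    ← Equiv.sum_comp (pairEquiv N)]
  simp only [map_add, map_pow, aeval_X, map_sum, map_mul, aeval_C, Complex.coe_algebraMap,
    pairEquiv_val]
  exact congrArg _ (Finset.sum_congr rfl fun k _ => mul_comm _ _)

/-- Differentiate P_x(t) = ∏ (t - r_k(x)) in x for fixed t, then let t be the m-th root at the base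
point: in the product rule only the term k = m survives. -/
theorem fderiv_coeffMap_eval (x h : Fin N ⊕ Fin N → ℝ) (m : Fin N ⊕ Fin N) :
    ∑ k, rootCLM m x ^ expo k * ((fderiv ℝ (fun x => coeffMap (toRoots N x)) x h k : ℝ) : ℂ) =
      -(∏ j ∈ Finset.univ.erase m, (rootCLM m x - rootCLM j x)) * rootCLM m h := by
  classical
  set t := rootCLM m x with ht
  have hF := (differentiable_coeffMap N x).hasFDerivAt
  set F' := fderiv ℝ (fun x => coeffMap (toRoots N x)) x
  let A : (Fin N ⊕ Fin N → ℝ) →L[ℝ] ℂ :=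
    ∑ k, t ^ expo k • Complex.ofRealCLM.comp (ContinuousLinearMap.proj k)
  have hA : ∀ b, A b = ∑ k, t ^ expo k * (b k : ℂ) := fun b => by
    simp [A]
  have h1 := A.hasFDerivAt.comp x hF
  have h2 : A ∘ (fun x => coeffMap (toRoots N x)) =
      fun x => ∏ k, (t - rootCLM k x) - t ^ (2 * N) := by
    ext y
    rw [Function.comp_apply, hA, eq_sub_iff_add_eq', ← aeval_rootPoly_eq_sum, aeval_rootPoly]
    simp only [rootCLM_apply]
  have h3 : HasFDerivAt (fun x => ∏ k, (t - rootCLM k x) - t ^ (2 * N))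
      (∑ k, (∏ j ∈ Finset.univ.erase k, (t - rootCLM j x)) • (-(rootCLM k))) x :=
    (HasFDerivAt.finsetProd (u := Finset.univ) (g := fun k x => t - rootCLM k x)
      (g' := fun k => -(rootCLM k))
      (fun k _ => ((rootCLM k).hasFDerivAt (x := x)).const_sub t)).sub_const _
  rw [h2] at h1
  have h4 := congrArg (fun T : (Fin N ⊕ Fin N → ℝ) →L[ℝ] ℂ => T h) (h1.unique h3)
  simp only [ContinuousLinearMap.comp_apply, hA, sum_apply,
    smul_apply, neg_apply] at h4
  rw [h4, Finset.sum_eq_single m]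
  · simp
  · intro k _ hk
    rw [Finset.prod_eq_zero (Finset.mem_erase.2 ⟨hk.symm, Finset.mem_univ m⟩) (by rw [ht, sub_self]),
      zero_smul]
  · simp

/-- The rows u + iv and u - iv give the determinant (-2i)^N. -/
theorem norm_det_rootCLM (N : ℕ) :
    ‖(Matrix.of fun m k : Fin N ⊕ Fin N => rootCLM m (Pi.single k 1)).det‖ = 2 ^ N := by
  have h : (Matrix.of fun m k : Fin N ⊕ Fin N => rootCLM m (Pi.single k 1)) =
      Matrix.fromBlocks 1 (Matrix.diagonal fun _ => Complex.I) 1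
        (Matrix.diagonal fun _ => -Complex.I) := by
    ext m k
    rw [Matrix.of_apply, rootCLM_apply]
    rcases m with m | m <;> rcases k with k | k <;> by_cases hmk : m = k <;>
      simp [rootVec, toRoots_apply, Pi.single_apply, hmk]
  rw [h, Matrix.det_fromBlocks_one₁₁, one_mul, Matrix.diagonal_sub, Matrix.det_diagonal]
  have h2 : -Complex.I - Complex.I = -(2 * Complex.I) := by ring
  simp [h2]

/-- Each unordered pair occurs twice on the left: the discriminant is the square of the Vandermonde
determinant up to sign. -/
theorem norm_prod_sub (v : Fin N ⊕ Fin N → ℂ) :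
    ‖∏ m, ∏ j ∈ Finset.univ.erase m, (v m - v j)‖ =
      ‖(Matrix.vandermonde fun i => v ((pairEquiv N).symm i)).det‖ ^ 2 := by
  classical
  rw [Matrix.det_vandermonde]
  simp only [norm_prod]
  have h := Finset.prod_prod_Ioi_mul_eq_prod_prod_off_diag (fun p q : Fin (2 * N) =>
    ‖v ((pairEquiv N).symm p) - v ((pairEquiv N).symm q)‖)
  have h1 : ∏ m, ∏ j ∈ Finset.univ.erase m, ‖v m - v j‖ =
      ∏ i, ∏ j ∈ {i}ᶜ, ‖v ((pairEquiv N).symm j) - v ((pairEquiv N).symm i)‖ := by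
    rw [← Equiv.prod_comp (pairEquiv N)]
    refine Finset.prod_congr rfl fun m _ => ?_
    refine Finset.prod_bij (fun j _ => pairEquiv N j) ?_ ?_ ?_ ?_
    · intro j hj
      simpa using hj
    · intro a _ b _ hab
      exact (pairEquiv N).injective hab
    · intro b hb
      refine ⟨(pairEquiv N).symm b, ?_, by simp⟩
      simp only [Finset.mem_erase, Finset.mem_univ, and_true]
      rintro rfl
      simp at hb
    · intro j _
      simp [norm_sub_rev]
  rw [h1, ← h]
  simp only [← Finset.prod_pow]
  refine Finset.prod_congr rfl fun i _ => Finset.prod_congr rfl fun j _ => ?_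
  rw [norm_sub_rev (v ((pairEquiv N).symm i)), sq]

theorem abs_det_fderiv_coeffMap (x : Fin N ⊕ Fin N → ℝ) (hx : vander (toRoots N x) ≠ 0) :
    |(fderiv ℝ (fun x => coeffMap (toRoots N x)) x).det| = 2 ^ N * ‖vander (toRoots N x)‖ := by
  classical
  set F' := fderiv ℝ (fun x => coeffMap (toRoots N x)) x with hF'
  let J := LinearMap.toMatrix' (F' : (Fin N ⊕ Fin N → ℝ) →ₗ[ℝ] (Fin N ⊕ Fin N → ℝ))
  have hJ : F'.det = J.det := (LinearMap.det_toMatrix' _).symm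
  -- The preceding derivative formula in matrix form. Taking norms of determinants gives |V| |J| =
  -- |V|² 2^N, and `hx` allows cancelling |V|.
  have hm : (Matrix.of fun m k : Fin N ⊕ Fin N => rootVec (toRoots N x) m ^ expo k) *
      J.map (algebraMap ℝ ℂ) =
      Matrix.diagonal (fun m => -(∏ j ∈ Finset.univ.erase m, (rootCLM m x - rootCLM j x))) *
        Matrix.of fun m k : Fin N ⊕ Fin N => rootCLM m (Pi.single k 1) := by
    ext m k
    rw [Matrix.diagonal_mul, Matrix.of_apply, ← fderiv_coeffMap_eval, Matrix.mul_apply]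
    refine Finset.sum_congr rfl fun i _ => ?_
    rw [Matrix.of_apply, rootCLM_apply, Matrix.map_apply]
    congr 2
  have hd := congrArg (fun M => ‖Matrix.det M‖) hm
  simp only [Matrix.det_mul, norm_mul, Matrix.det_diagonal, norm_det_rootCLM] at hd
  have h1 : (J.map (algebraMap ℝ ℂ)).det = ((J.det : ℝ) : ℂ) := by
    rw [← RingHom.mapMatrix_apply, ← RingHom.map_det]; rfl
  rw [h1, ← hJ, Complex.norm_real, Finset.prod_neg, norm_mul, norm_pow, norm_neg, norm_one,
    one_pow, one_mul, norm_prod_sub (fun m => rootCLM m x), ← vander] at hd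
  simp only [rootCLM_apply] at hd
  rw [← vander_eq_det_vandermonde, Real.norm_eq_abs] at hd
  refine mul_left_cancel₀ (norm_ne_zero_iff.2 hx) ?_
  rw [hd]
  ring

/-! ### The phase of the Vandermonde determinant -/

theorem prod_vandermonde_range (w : ℕ → ℂ) (n : ℕ) :
    (Matrix.vandermonde fun i : Fin n => w i).det =
      ∏ q ∈ Finset.range n, ∏ p ∈ Finset.range q, (w q - w p) := by
  rw [Matrix.det_vandermonde, Finset.prod_range,
    Finset.prod_comm' (t' := Finset.univ) (s' := fun j => Finset.Iio j) (by simp)]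
  refine Finset.prod_congr rfl fun q _ => ?_
  rw [← Nat.Iio_eq_range, ← Fin.map_valEmbedding_Iio, Finset.prod_map]
  rfl

/-- The interleaving of a sequence with its conjugates. -/
def interleave (z : ℕ → ℂ) (m : ℕ) : ℂ := if Even m then z (m / 2) else conj (z (m / 2))

theorem prod_range_two_mul (f : ℕ → ℂ) (N : ℕ) :
    ∏ m ∈ Finset.range (2 * N), f m = ∏ j ∈ Finset.range N, f (2 * j) * f (2 * j + 1) := by
  induction N with
  | zero => simp
  | succ N ih =>
    rw [show 2 * (N + 1) = 2 * N + 1 + 1 by ring, Finset.prod_range_succ, Finset.prod_range_succ,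
      ih, Finset.prod_range_succ, mul_assoc]

theorem interleave_even (z : ℕ → ℂ) (j : ℕ) : interleave z (2 * j) = z j := by
  simp [interleave]

theorem interleave_odd (z : ℕ → ℂ) (j : ℕ) : interleave z (2 * j + 1) = conj (z j) := by
  rw [interleave, if_neg (by simp), show (2 * j + 1) / 2 = j by omega]

/-- A new pair z, conj z contributes its own difference conj z - z = -2i Im z, which I turns into 2
Im z ≥ 0. Its differences with the earlier pairs group into conjugate factors, hence squared norms.
-/
theorem I_pow_mul_prod_interleave (z : ℕ → ℂ) (N : ℕ) (hz : ∀ j < N, 0 ≤ (z j).im) :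
    ∃ r : ℝ, 0 ≤ r ∧ Complex.I ^ N * ∏ q ∈ Finset.range (2 * N), ∏ p ∈ Finset.range q,
      (interleave z q - interleave z p) = r := by
  induction N with
  | zero => exact ⟨1, zero_le_one, by simp⟩
  | succ N ih =>
    obtain ⟨r, hr, h⟩ := ih fun j hj => hz j (by omega)
    refine ⟨r * (2 * (z N).im) * ∏ j ∈ Finset.range N,
      (Complex.normSq (z N - z j) * Complex.normSq (z N - conj (z j))), ?_, ?_⟩
    · have := hz N (by omega)
      exact mul_nonneg (by positivity) (Finset.prod_nonneg fun j _ =>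
        mul_nonneg (Complex.normSq_nonneg _) (Complex.normSq_nonneg _))
    · rw [show 2 * (N + 1) = 2 * N + 1 + 1 by ring, Finset.prod_range_succ,
        Finset.prod_range_succ, Finset.prod_range_succ (n := 2 * N) (f := fun p => _ - _),
        prod_range_two_mul (fun p => interleave z (2 * N) - interleave z p),
        prod_range_two_mul (fun p => interleave z (2 * N + 1) - interleave z p)]
      simp only [interleave_even, interleave_odd]
      push_cast
      rw [← h]
      have hn : ∀ w : ℂ, (Complex.normSq w : ℂ) = w * conj w := fun w => (Complex.mul_conj w).symm
      have hi : (2 : ℂ) * (z N).im = Complex.I * (conj (z N) - z N) := by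
        apply Complex.ext <;> simp; ring
      simp only [hn, hi, map_sub, Complex.conj_conj]
      have hprod : (∏ j ∈ Finset.range N, (z N - z j) * (z N - conj (z j))) *
          (∏ j ∈ Finset.range N, (conj (z N) - z j) * (conj (z N) - conj (z j))) =
          ∏ j ∈ Finset.range N, (z N - z j) * (conj (z N) - conj (z j)) *
            ((z N - conj (z j)) * (conj (z N) - z j)) := by
        rw [← Finset.prod_mul_distrib]
        exact Finset.prod_congr rfl fun j _ => by ring
      rw [← hprod]
      ring

theorem norm_vander (z : Fin N → ℂ) (hz : ∀ j, 0 ≤ (z j).im) :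
    ((‖vander z‖ : ℝ) : ℂ) = Complex.I ^ N * vander z := by
  let z' : ℕ → ℂ := fun j => if h : j < N then z ⟨j, h⟩ else 0
  have hz' : ∀ j : Fin N, z' j = z j := fun j => by simp [z']
  have h1 : vander z = ∏ q ∈ Finset.range (2 * N), ∏ p ∈ Finset.range q,
      (interleave z' q - interleave z' p) := by
    rw [← prod_vandermonde_range, vander_eq_det_vandermonde]
    congr 2
    ext i
    obtain ⟨k, rfl⟩ := (pairEquiv N).surjective i
    rw [Equiv.symm_apply_apply, pairEquiv_val]
    rcases k with j | j
    · simp only [rootVec, expo, Sum.elim_inl, interleave_even, hz']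
    · simp only [rootVec, expo, Sum.elim_inr, interleave_odd, hz']
  obtain ⟨r, hr, h⟩ := I_pow_mul_prod_interleave z' N fun j hj => by
    rw [← Fin.val_mk hj, hz']; exact hz _
  rw [← h1] at h
  rw [h]
  have := congrArg norm h
  rw [norm_mul, norm_pow, Complex.norm_I, one_pow, one_mul, Complex.norm_real,
    Real.norm_of_nonneg hr] at this
  rw [this]

/-! ### Ordering the roots -/

/-- The tuples of points of the upper half disc. -/
def rootBox (N : ℕ) : Set (Fin N → ℂ) := Set.univ.pi fun _ => halfDisc

/-- The tuples of points of the upper half disc with increasing real parts. -/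
def orderedRoots (N : ℕ) : Set (Fin N → ℂ) :=
  {z | z ∈ rootBox N ∧ StrictMono fun j => (z j).re}

/-- The tuples two entries of which have the same real part. -/
def tiedRoots (N : ℕ) : Set (Fin N → ℂ) := {z | ∃ i j, i ≠ j ∧ (z i).re = (z j).re}

theorem mem_rootBox {z : Fin N → ℂ} : z ∈ rootBox N ↔ ∀ j, z j ∈ halfDisc := by
  simp [rootBox]

theorem measurableSet_rootBox (N : ℕ) : MeasurableSet (rootBox N) :=
  MeasurableSet.univ_pi fun _ => measurableSet_halfDisc

theorem measurableSet_orderedRoots (N : ℕ) : MeasurableSet (orderedRoots N) := by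
  have h : orderedRoots N =
      rootBox N ∩ ⋂ i : Fin N, ⋂ j : Fin N, ⋂ _ : i < j, {z | (z i).re < (z j).re} := by
    ext z
    simp [orderedRoots, StrictMono]
  rw [h]
  refine (measurableSet_rootBox N).inter <| MeasurableSet.iInter fun i => MeasurableSet.iInter
    fun j => MeasurableSet.iInter fun _ => measurableSet_lt ?_ ?_ <;> fun_prop

/-- A finite union of proper real subspaces. -/
theorem volume_tiedRoots (N : ℕ) : volume (tiedRoots N) = 0 := by
  have h : tiedRoots N = ⋃ i : Fin N, ⋃ j : Fin N, ⋃ _ : i ≠ j, {z | (z i).re = (z j).re} := by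
    ext z
    simp [tiedRoots]
  rw [h]
  refine measure_iUnion_null fun i => measure_iUnion_null fun j => measure_iUnion_null fun hij => ?_
  let f : (Fin N → ℂ) →ₗ[ℝ] ℝ := Complex.reLm.comp (LinearMap.proj i) -
    Complex.reLm.comp (LinearMap.proj j)
  have hf : ({z | (z i).re = (z j).re} : Set (Fin N → ℂ)) = LinearMap.ker f := by
    ext z
    simp [f, sub_eq_zero]
  rw [hf]
  refine Measure.addHaar_submodule _ _ fun htop => ?_
  have : f (Pi.single i 1) = 0 := by
    rw [← LinearMap.mem_ker, htop]; trivial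
  simp [f, hij.symm] at this

theorem rootVec_of_aeval_eq_zero {z : Fin N → ℂ} {t : ℂ} (h : aeval t (rootPoly z) = 0) :
    ∃ k, t = rootVec z k := by
  rw [aeval_rootPoly, Finset.prod_eq_zero_iff] at h
  obtain ⟨k, _, hk⟩ := h
  exact ⟨k, sub_eq_zero.1 hk⟩

theorem aeval_rootVec (z : Fin N → ℂ) (k : Fin N ⊕ Fin N) :
    aeval (rootVec z k) (rootPoly z) = 0 := by
  rw [aeval_rootPoly]
  exact Finset.prod_eq_zero (Finset.mem_univ k) (sub_self _)

theorem exists_eq_of_aeval_eq_zero {z : Fin N → ℂ} (hz : z ∈ rootBox N) {t : ℂ} (ht : 0 < t.im)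
    (h : aeval t (rootPoly z) = 0) : ∃ j, t = z j := by
  obtain ⟨k, rfl⟩ := rootVec_of_aeval_eq_zero h
  rcases k with j | j
  · exact ⟨j, rfl⟩
  · have := (mem_rootBox.1 hz j).1
    simp only [rootVec, Sum.elim_inr, Complex.conj_im] at ht
    linarith

/-- The polynomial determines the set of its roots in the upper half plane, hence the set of their
real parts. A strictly increasing enumeration is determined by its range. -/
theorem rootPoly_injOn : Set.InjOn rootPoly (orderedRoots N) := by
  have key : ∀ z ∈ orderedRoots N, ∀ z' ∈ orderedRoots N, rootPoly z = rootPoly z' →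
      ∀ j, ∃ k, z j = z' k := by
    intro z hz z' hz' h j
    apply exists_eq_of_aeval_eq_zero hz'.1 (mem_rootBox.1 hz.1 j).1
    rw [← h]
    exact aeval_rootVec z (Sum.inl j)
  intro z hz z' hz' h
  have h1 := key z hz z' hz' h
  have h2 := key z' hz' z hz h.symm
  have hr : (fun j => (z j).re) = fun j => (z' j).re := by
    rw [← hz.2.range_inj hz'.2]
    apply Set.Subset.antisymm
    · rintro _ ⟨j, rfl⟩
      obtain ⟨k, hk⟩ := h1 j
      exact ⟨k, by simp only [hk]⟩
    · rintro _ ⟨j, rfl⟩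
      obtain ⟨k, hk⟩ := h2 j
      exact ⟨k, by simp only [hk]⟩
  ext1 j
  obtain ⟨k, hk⟩ := h1 j
  have : (z' k).re = (z' j).re := by rw [← hk]; exact congrFun hr j
  rw [hk, hz'.2.injective this]

theorem coeffMap_mem {z : Fin N → ℂ} (hz : z ∈ rootBox N) :
    coeffEquiv N (coeffMap z) ∈ OmegaComplex N := by
  rw [mem_rootBox] at hz
  refine ⟨fun t ht => ?_, fun x hx => ?_⟩
  · rw [monicPoly_coeffMap] at ht
    obtain ⟨k, rfl⟩ := rootVec_of_aeval_eq_zero ht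
    rcases k with j | j
    · exact (hz j).2
    · simpa [rootVec] using (hz j).2
  · rw [monicPoly_coeffMap] at hx
    have h : aeval (x : ℂ) (rootPoly z) = 0 := by
      have := aeval_algebraMap_apply_eq_algebraMap_eval (A := ℂ) x (rootPoly z)
      rw [hx, map_zero] at this
      exact this
    obtain ⟨k, hk⟩ := rootVec_of_aeval_eq_zero h
    have him := congrArg Complex.im hk
    rcases k with j | j
    · simp only [rootVec, Sum.elim_inl, Complex.ofReal_im] at him
      exact (hz j).1.ne him
    · simp only [rootVec, Sum.elim_inr, Complex.ofReal_im, Complex.conj_im] at him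
      have := (hz j).1
      linarith

theorem exists_rootPoly_eq (N : ℕ) (p : ℝ[X]) (hp : p.Monic) (hd : p.natDegree = 2 * N)
    (hr : ∀ x : ℝ, p.eval x ≠ 0) :
    ∃ z : Fin N → ℂ, (∀ j, 0 < (z j).im) ∧ p = rootPoly z := by
  induction N generalizing p with
  | zero =>
    refine ⟨Fin.elim0, fun j => j.elim0, ?_⟩
    rw [eq_one_of_monic_natDegree_zero hp (by simpa using hd)]
    simp [rootPoly]
  | succ N ih =>
    obtain ⟨w, hw⟩ := IsAlgClosed.exists_aeval_eq_zero ℂ p 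
      (natDegree_pos_iff_degree_pos.1 (by omega)).ne'
    have hw0 : w.im ≠ 0 := by
      intro h
      have hwr : w = algebraMap ℝ ℂ w.re := by apply Complex.ext <;> simp [h]
      rw [hwr, aeval_algebraMap_apply_eq_algebraMap_eval] at hw
      exact hr w.re (by simpa using hw)
    obtain ⟨v, hv, hv0⟩ : ∃ v : ℂ, aeval v p = 0 ∧ 0 < v.im := by
      rcases lt_or_gt_of_ne hw0 with h | h
      · refine ⟨conj w, ?_, by simpa using h⟩
        rw [aeval_conj, hw, map_zero]
      · exact ⟨w, hw, h⟩
    obtain ⟨q, hq⟩ := quadratic_dvd_of_aeval_eq_zero_im_ne_zero p hv hv0.ne'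
    rw [← Complex.normSq_eq_norm_sq] at hq
    have hm : (X ^ 2 - C (2 * v.re) * X + C (Complex.normSq v) : ℝ[X]).Monic := by
      have := rootPoly_monic (N := 1) fun _ => v
      simpa [rootPoly] using this
    have hm2 : (X ^ 2 - C (2 * v.re) * X + C (Complex.normSq v) : ℝ[X]).natDegree = 2 := by
      have := rootPoly_natDegree (N := 1) fun _ => v
      simpa [rootPoly] using this
    have hqm : q.Monic := hm.of_mul_monic_left (hq ▸ hp)
    obtain ⟨z, hz, rfl⟩ := ih q hqm (by
        rw [hq, hm.natDegree_mul hqm, hm2] at hd; omega)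
      (fun x hx => hr x (by rw [hq, eval_mul, hx, mul_zero]))
    refine ⟨Fin.cons v z, Fin.cases hv0 hz, ?_⟩
    rw [hq]
    simp [rootPoly, Fin.prod_univ_succ]

theorem rootPoly_comp_perm (z : Fin N → ℂ) (σ : Equiv.Perm (Fin N)) :
    rootPoly (z ∘ σ) = rootPoly z :=
  Equiv.prod_comp σ fun j => (X ^ 2 - C (2 * (z j).re) * X + C (Complex.normSq (z j)) : ℝ[X])

theorem exists_coeffMap_eq {b : Fin N ⊕ Fin N → ℝ} (hb : coeffEquiv N b ∈ OmegaComplex N) :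
    ∃ z ∈ orderedRoots N ∪ tiedRoots N, b = coeffMap z := by
  have hm : (monicPoly (coeffEquiv N b)).Monic ∧ (monicPoly (coeffEquiv N b)).natDegree = 2 * N := by
    have hdeg : (∑ i : Fin (2 * N), C (coeffEquiv N b i) * X ^ (i.rev : ℕ)).degree <
        ((2 * N : ℕ) : WithBot ℕ) := by
      refine (degree_sum_le _ _).trans_lt ((Finset.sup_lt_iff (WithBot.bot_lt_coe _)).2 fun i _ => ?_)
      exact (degree_C_mul_X_pow_le _ _).trans_lt (by exact_mod_cast i.rev.2)
    exact ⟨monic_X_pow_add hdeg, natDegree_eq_of_degree_eq_some (by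
      unfold monicPoly
      rw [degree_add_eq_left_of_degree_lt (by rwa [degree_X_pow]), degree_X_pow])⟩
  obtain ⟨z, hz, hzp⟩ := exists_rootPoly_eq N _ hm.1 hm.2 hb.2
  have hbox : z ∈ rootBox N := mem_rootBox.2 fun j =>
    ⟨hz j, hb.1 _ (hzp ▸ aeval_rootVec z (Sum.inl j))⟩
  let σ := Tuple.sort fun j => (z j).re
  have hmono : Monotone fun j => (z (σ j)).re := Tuple.monotone_sort fun j => (z j).re
  refine ⟨z ∘ σ, ?_, coeffMap_of_monicPoly (hzp.trans (rootPoly_comp_perm z σ).symm)⟩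
  by_cases hi : Function.Injective fun j => (z (σ j)).re
  · exact Or.inl ⟨mem_rootBox.2 fun j => mem_rootBox.1 hbox _, hmono.strictMono_of_injective hi⟩
  · simp only [Function.Injective, not_forall] at hi
    obtain ⟨i, j, hij, hne⟩ := hi
    exact Or.inr ⟨i, j, hne, hij⟩

/-- The coefficients as functions of the real and imaginary parts of the roots. -/
def coeffOfParts (N : ℕ) (x : Fin N ⊕ Fin N → ℝ) : Fin N ⊕ Fin N → ℝ := coeffMap (toRoots N x)

theorem injOn_coeffOfParts (N : ℕ) : Set.InjOn (coeffOfParts N) (toRoots N ⁻¹' orderedRoots N) := by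
  intro x hx y hy h
  apply (toRoots_bijective N).1
  apply rootPoly_injOn hx hy
  rw [← monicPoly_coeffMap, ← monicPoly_coeffMap]
  exact congrArg (fun b => monicPoly (coeffEquiv N b)) h

/-- What the ordered tuples miss comes from tuples with ties, and a differentiable map sends this
null set to a null set. -/
theorem image_coeffOfParts_ae_eq (N : ℕ) :
    coeffOfParts N '' (toRoots N ⁻¹' orderedRoots N) =ᵐ[volume] coeffEquiv N ⁻¹' OmegaComplex N := by
  have h1 : coeffOfParts N '' (toRoots N ⁻¹' orderedRoots N) ⊆ coeffEquiv N ⁻¹' OmegaComplex N := by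
    rintro _ ⟨x, hx, rfl⟩
    exact coeffMap_mem hx.1
  have h2 : coeffEquiv N ⁻¹' OmegaComplex N ⊆ coeffOfParts N '' (toRoots N ⁻¹' orderedRoots N) ∪
      coeffOfParts N '' (toRoots N ⁻¹' tiedRoots N) := by
    intro b hb
    obtain ⟨z, hz, rfl⟩ := exists_coeffMap_eq hb
    obtain ⟨x, rfl⟩ := (toRoots_bijective N).2 z
    rcases hz with hz | hz
    · exact Or.inl ⟨x, hz, rfl⟩
    · exact Or.inr ⟨x, hz, rfl⟩
  have h3 : volume (coeffOfParts N '' (toRoots N ⁻¹' tiedRoots N)) = 0 := by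
    apply addHaar_image_eq_zero_of_differentiableOn_of_addHaar_eq_zero
    · exact (differentiable_coeffMap N).differentiableOn
    · rw [(measurePreserving_toRoots N).measure_preimage_emb (measurableEmbedding_toRoots N),
        volume_tiedRoots]
  refine Filter.EventuallyLE.antisymm h1.eventuallyLE ?_
  refine h2.eventuallyLE.trans ?_
  exact (union_ae_eq_left_of_ae_eq_empty (ae_eq_empty.2 h3)).le

/-- Real parts separate the z_j from each other; the sign of the imaginary part separates them from
the conjugates. -/
theorem vander_ne_zero {z : Fin N → ℂ} (hz : z ∈ orderedRoots N) : vander z ≠ 0 := by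
  rw [vander_eq_det_vandermonde, Matrix.det_vandermonde_ne_zero_iff]
  refine Function.Injective.comp ?_ (pairEquiv N).symm.injective
  have him := fun j => (mem_rootBox.1 hz.1 j).1
  rintro (i | i) (j | j) h <;> simp only [Sum.elim_inl, Sum.elim_inr] at h
  · rw [hz.2.injective (congrArg Complex.re h)]
  · have := congrArg Complex.im h
    rw [Complex.conj_im] at this
    linarith [him i, him j]
  · have := congrArg Complex.im h
    rw [Complex.conj_im] at this
    linarith [him i, him j]
  · have h := (starRingEnd ℂ).injective h
    rw [hz.2.injective (congrArg Complex.re h)]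

theorem norm_vander_comp_perm (z : Fin N → ℂ) (σ : Equiv.Perm (Fin N)) :
    ‖vander (z ∘ σ)‖ = ‖vander z‖ := by
  have h : (Matrix.of fun m k : Fin N ⊕ Fin N => rootVec (z ∘ σ) m ^ expo k) =
      (Matrix.of fun m k : Fin N ⊕ Fin N => rootVec z m ^ expo k).submatrix
        (Equiv.Perm.sumCongr σ σ) id := by
    ext m k
    rcases m with m | m <;> simp [rootVec]
  rw [vander, h, Matrix.det_permute, norm_mul, ← vander]
  rcases Int.units_eq_one_or (Equiv.Perm.sign (Equiv.Perm.sumCongr σ σ)) with h | h <;> simp [h]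

theorem rootBox_ae_eq_iUnion (N : ℕ) :
    rootBox N =ᵐ[volume]
      ⋃ σ : Equiv.Perm (Fin N), (fun z : Fin N → ℂ => z ∘ σ) ⁻¹' orderedRoots N := by
  refine Filter.EventuallyLE.antisymm ?_ (LE.le.eventuallyLE ?_)
  · have h : rootBox N ⊆ (⋃ σ : Equiv.Perm (Fin N),
        (fun z : Fin N → ℂ => z ∘ σ) ⁻¹' orderedRoots N) ∪ tiedRoots N := by
      intro z hz
      by_cases hi : Function.Injective fun j => (z j).re
      · left
        refine Set.mem_iUnion.2 ⟨Tuple.sort fun j => (z j).re,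
          mem_rootBox.2 fun j => mem_rootBox.1 hz _, ?_⟩
        exact (Tuple.monotone_sort fun j => (z j).re).strictMono_of_injective
          (hi.comp (Equiv.injective _))
      · right
        simp only [Function.Injective, not_forall] at hi
        obtain ⟨i, j, hij, hne⟩ := hi
        exact ⟨i, j, hne, hij⟩
    exact h.eventuallyLE.trans
      (union_ae_eq_left_of_ae_eq_empty (ae_eq_empty.2 (volume_tiedRoots N))).le
  · intro z hz
    obtain ⟨σ, hσ⟩ := Set.mem_iUnion.1 hz
    refine mem_rootBox.2 fun j => ?_
    simpa using mem_rootBox.1 hσ.1 (σ.symm j)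

theorem measurePreserving_comp_perm (σ : Equiv.Perm (Fin N)) :
    MeasurePreserving fun z : Fin N → ℂ => z ∘ σ := by
  have h := volume_measurePreserving_piCongrLeft (fun _ : Fin N => ℂ) σ.symm
  have he : (fun z : Fin N → ℂ => z ∘ σ) = MeasurableEquiv.piCongrLeft (fun _ => ℂ) σ.symm := by
    ext z j
    have := Equiv.piCongrLeft_apply_apply (fun _ : Fin N => ℂ) σ.symm z (σ j)
    rw [Equiv.symm_apply_apply] at this
    exact this.symm
  rw [he]
  exact h

theorem measurableEmbedding_comp_perm (σ : Equiv.Perm (Fin N)) :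
    MeasurableEmbedding fun z : Fin N → ℂ => z ∘ σ :=
  (by fun_prop : Continuous fun z : Fin N → ℂ => z ∘ σ).measurableEmbedding
    (σ.surjective.injective_comp_right)

/-- Up to ties, the box is the disjoint union of N! permuted copies of the ordered region. -/
theorem integral_rootBox_eq {G : (Fin N → ℂ) → ℂ} (hG : ∀ z (σ : Equiv.Perm (Fin N)), G (z ∘ σ) = G z)
    (hi : IntegrableOn G (rootBox N)) :
    ∫ z in rootBox N, G z = N.factorial * ∫ z in orderedRoots N, G z := by
  rw [setIntegral_congr_set (rootBox_ae_eq_iUnion N), integral_iUnion_fintype]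
  · have : ∀ σ : Equiv.Perm (Fin N), ∫ z in (fun z : Fin N → ℂ => z ∘ σ) ⁻¹' orderedRoots N, G z =
        ∫ z in orderedRoots N, G z := fun σ => by
      have h := (measurePreserving_comp_perm σ).setIntegral_preimage_emb
        (measurableEmbedding_comp_perm σ) G (orderedRoots N)
      simpa only [hG] using h
    simp [this, Fintype.card_perm]
  · exact fun σ => (measurePreserving_comp_perm σ).measurable (measurableSet_orderedRoots N)
  · intro σ τ hne
    refine Set.disjoint_left.2 fun z hσ hτ => hne ?_
    -- Two permutations sorting the same real parts give the same sorted tuple; as the real parts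
    -- are distinct, they coincide.
    have h1 := Tuple.unique_monotone (f := fun j => (z j).re) hσ.2.monotone hτ.2.monotone
    have hinj : Function.Injective fun j => (z j).re := by
      have := hσ.2.injective.comp σ.symm.injective
      intro i j hij
      exact this (by simpa using hij)
    ext1 j
    exact hinj (congrFun h1 j)
  · exact fun σ => (hi.congr_set_ae (rootBox_ae_eq_iUnion N).symm).mono_set
      (Set.subset_iUnion (fun σ : Equiv.Perm (Fin N) =>
        (fun z : Fin N → ℂ => z ∘ σ) ⁻¹' orderedRoots N) σ)

/-! ### Evaluation of the integral -/

theorem prod_cpow_ofReal_nonneg {ι : Type*} (s : Finset ι) (f : ι → ℝ) (hf : ∀ i, 0 ≤ f i) (c : ℂ) :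
    ((∏ i ∈ s, f i : ℝ) : ℂ) ^ c = ∏ i ∈ s, (f i : ℂ) ^ c := by
  classical
  induction s using Finset.induction_on with
  | empty => simp
  | insert i s hi ih =>
    rw [Finset.prod_insert hi, Finset.prod_insert hi, Complex.ofReal_mul,
      Complex.mul_cpow_ofReal_nonneg (hf i) (Finset.prod_nonneg fun j _ => hf j), ih]

theorem integrand_coeffMap (α : ℂ) (z : Fin N → ℂ) :
    integrand N α (coeffEquiv N (coeffMap z)) = ∏ j, ((‖z j‖ ^ 2 : ℝ) : ℂ) ^ (α - 1) := by
  unfold integrand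
  rw [monicPoly_coeffMap, ← prod_cpow_ofReal_nonneg _ _ fun j => by positivity]
  congr 2
  have : (rootPoly z).coeff 0 = ∏ j, ‖z j‖ ^ 2 := by
    rw [coeff_zero_eq_eval_zero, rootPoly, eval_prod]
    simp [Complex.normSq_eq_norm_sq]
  rw [this, abs_of_nonneg (Finset.prod_nonneg fun j _ => by positivity)]

/-- The pulled back integrand on tuples of roots, without the factor `2 ^ N` of the Jacobian. -/
def rootIntegrand (α : ℂ) (z : Fin N → ℂ) : ℂ :=
  ‖vander z‖ * ∏ j, ((‖z j‖ ^ 2 : ℝ) : ℂ) ^ (α - 1)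

/-- After `norm_vander`, the Leibniz formula distributes the exponents among the z_j and their
conjugates, so each term is a product of functions of one variable. -/
theorem rootIntegrand_eq_sum (α : ℂ) {z : Fin N → ℂ} (hz : z ∈ rootBox N) :
    rootIntegrand α z = ∑ σ : Equiv.Perm (Fin N ⊕ Fin N), Complex.I ^ N * ((Equiv.Perm.sign σ : ℤ) *
      ∏ j, momentFun α (expo (σ (Sum.inl j))) (expo (σ (Sum.inr j))) (z j)) := by
  rw [rootIntegrand, norm_vander z fun j => (mem_rootBox.1 hz j).1.le, vander,
    ← Matrix.det_transpose, Matrix.det_apply', Finset.mul_sum, Finset.sum_mul]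
  refine Finset.sum_congr rfl fun σ _ => ?_
  simp only [momentFun, Finset.prod_mul_distrib, Fintype.prod_sum_type, Matrix.transpose_apply,
    Matrix.of_apply, rootVec, Sum.elim_inl, Sum.elim_inr]
  ring

theorem restrict_rootBox (N : ℕ) :
    (volume : Measure (Fin N → ℂ)).restrict (rootBox N) =
      Measure.pi fun _ => (volume : Measure ℂ).restrict halfDisc := by
  rw [volume_pi, rootBox, Measure.restrict_pi_pi]

theorem expo_ne {σ : Equiv.Perm (Fin N ⊕ Fin N)} (j : Fin N) :
    expo (σ (Sum.inl j)) ≠ expo (σ (Sum.inr j)) := fun h => by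
  simpa using σ.injective (expo_injective h)

theorem integrable_prod_momentFun {α : ℂ} (hα : -(1 / 2 : ℝ) < α.re)
    (σ : Equiv.Perm (Fin N ⊕ Fin N)) :
    IntegrableOn (fun z : Fin N → ℂ =>
      ∏ j, momentFun α (expo (σ (Sum.inl j))) (expo (σ (Sum.inr j))) (z j)) (rootBox N) := by
  rw [IntegrableOn, restrict_rootBox]
  exact Integrable.fintype_prod fun j => integrableOn_momentFun hα (by have := expo_ne (σ := σ) j; omega)

theorem integrableOn_rootIntegrand {α : ℂ} (hα : -(1 / 2 : ℝ) < α.re) :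
    IntegrableOn (rootIntegrand α) (rootBox N) := by
  have h : IntegrableOn (fun z : Fin N → ℂ => ∑ σ : Equiv.Perm (Fin N ⊕ Fin N),
      Complex.I ^ N * ((Equiv.Perm.sign σ : ℤ) *
        ∏ j, momentFun α (expo (σ (Sum.inl j))) (expo (σ (Sum.inr j))) (z j))) (rootBox N) :=
    integrable_finsetSum _ fun σ _ => ((integrable_prod_momentFun hα σ).const_mul _).const_mul _
  exact h.congr_fun (fun z hz => (rootIntegrand_eq_sum α hz).symm) (measurableSet_rootBox N)

theorem moment_even_odd (α : ℂ) (i j : ℕ) :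
    moment α (2 * i) (2 * j + 1) =
      -(2 * Complex.I) * ((2 * j + 1 + α) ^ 2 - (2 * i + α) ^ 2)⁻¹ := by
  rw [moment, if_neg (by rw [Nat.not_even_iff_odd]; exact ⟨i + j, by ring⟩), div_eq_mul_inv,
    neg_mul, ← mul_neg, ← inv_neg]
  congr 2
  push_cast
  ring

theorem two_pow_mul_integral_rootBox {α : ℂ} (hα : -(1 / 2 : ℝ) < α.re) :
    2 ^ N * ∫ z in rootBox N, rootIntegrand α z = N.factorial * cauchyForm N α := by
  have h1 : ∫ z in rootBox N, rootIntegrand α z = Complex.I ^ N *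
      ∑ σ : Equiv.Perm (Fin N ⊕ Fin N), pairTerm (fun k l => moment α (expo k) (expo l)) σ := by
    rw [setIntegral_congr_fun (measurableSet_rootBox N) fun z hz => rootIntegrand_eq_sum α hz,
      integral_finsetSum _ fun σ _ =>
        ((integrable_prod_momentFun hα σ).const_mul _).const_mul _, Finset.mul_sum]
    refine Finset.sum_congr rfl fun σ _ => ?_
    rw [integral_const_mul, integral_const_mul, restrict_rootBox, pairTerm,
      integral_fintype_prod_eq_prod]
    congr 2
    exact Finset.prod_congr rfl fun j _ => integral_momentFun hα (expo_ne j)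
  rw [h1, sum_pairTerm_eq_det (A := fun k l : Fin N ⊕ Fin N => moment α (expo k) (expo l))
    (fun k l => moment_antisymm α _ _)
    (fun i j => if_pos ⟨i + j, by simp only [expo, Sum.elim_inl]; ring⟩)
    (fun i j => if_pos ⟨i + j + 1, by simp only [expo, Sum.elim_inr]; ring⟩), Fintype.card_fin]
  have h2 : (Matrix.of fun i j : Fin N => moment α (expo (Sum.inl i)) (expo (Sum.inr j))) =
      (-(2 * Complex.I)) • Matrix.of fun i j : Fin N =>
        ((2 * (j : ℕ) + 1 + α) ^ 2 - (2 * (i : ℕ) + α) ^ 2)⁻¹ := by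
    ext i j
    exact moment_even_odd α i j
  rw [h2, Matrix.det_smul, Fintype.card_fin, cauchyForm]
  -- The four factors come from the Jacobian, the phase of the Vandermonde determinant, the swaps
  -- inside pairs, and the numerators of the moments.
  have h3 : (2 : ℂ) ^ N * Complex.I ^ N * 2 ^ N * (-(2 * Complex.I)) ^ N = 8 ^ N := by
    rw [← mul_pow, ← mul_pow, ← mul_pow]
    congr 1
    linear_combination (-8 : ℂ) * Complex.I_sq
  linear_combination (N.factorial : ℂ) * (Matrix.of fun i j : Fin N =>
    ((2 * (j : ℕ) + 1 + α) ^ 2 - (2 * (i : ℕ) + α) ^ 2)⁻¹).det * h3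

theorem rootIntegrand_comp_perm (α : ℂ) (z : Fin N → ℂ) (σ : Equiv.Perm (Fin N)) :
    rootIntegrand α (z ∘ σ) = rootIntegrand α z := by
  rw [rootIntegrand, norm_vander_comp_perm, rootIntegrand]
  congr 1
  exact Equiv.prod_comp σ fun j => ((‖z j‖ ^ 2 : ℝ) : ℂ) ^ (α - 1)

theorem abs_det_smul_integrand (α : ℂ) {x : Fin N ⊕ Fin N → ℝ}
    (hx : x ∈ toRoots N ⁻¹' orderedRoots N) :
    |(fderiv ℝ (coeffOfParts N) x).det| • integrand N α (coeffEquiv N (coeffOfParts N x)) =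
      2 ^ N * rootIntegrand α (toRoots N x) := by
  have h := abs_det_fderiv_coeffMap x (vander_ne_zero hx)
  unfold coeffOfParts
  rw [h, integrand_coeffMap, rootIntegrand, Complex.real_smul]
  push_cast
  ring

theorem hasFDerivWithinAt_coeffOfParts (x : Fin N ⊕ Fin N → ℝ) (s : Set (Fin N ⊕ Fin N → ℝ)) :
    HasFDerivWithinAt (coeffOfParts N) (fderiv ℝ (coeffOfParts N) x) s x :=
  (differentiable_coeffMap N x).hasFDerivAt.hasFDerivWithinAt

theorem integrableOn_integrand {α : ℂ} (hα : -(1 / 2 : ℝ) < α.re) :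
    IntegrableOn (integrand N α) (OmegaComplex N) := by
  have hm : MeasurableSet (toRoots N ⁻¹' orderedRoots N) :=
    (measurePreserving_toRoots N).measurable (measurableSet_orderedRoots N)
  rw [← (measurePreserving_coeffEquiv N).integrableOn_comp_preimage
    (coeffEquiv N).measurableEmbedding]
  refine IntegrableOn.congr_set_ae ?_ (image_coeffOfParts_ae_eq N).symm
  rw [integrableOn_image_iff_integrableOn_abs_det_fderiv_smul volume hm
    (fun x _ => hasFDerivWithinAt_coeffOfParts x _) (injOn_coeffOfParts N)]
  refine IntegrableOn.congr_fun (f := (fun z => 2 ^ N * rootIntegrand α z) ∘ toRoots N) ?_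
    (fun x hx => (abs_det_smul_integrand α hx).symm) hm
  rw [(measurePreserving_toRoots N).integrableOn_comp_preimage (measurableEmbedding_toRoots N)]
  exact ((integrableOn_rootIntegrand hα).mono_set fun z hz => hz.1).const_mul _

theorem Cminus_eq_cauchyForm {α : ℂ} (hα : -(1 / 2 : ℝ) < α.re) :
    Cminus N α = cauchyForm N α := by
  have hm : MeasurableSet (toRoots N ⁻¹' orderedRoots N) :=
    (measurePreserving_toRoots N).measurable (measurableSet_orderedRoots N)
  have h1 : Cminus N α = 2 ^ N * ∫ z in orderedRoots N, rootIntegrand α z := by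
    rw [Cminus, ← (measurePreserving_coeffEquiv N).setIntegral_preimage_emb
      (coeffEquiv N).measurableEmbedding, ← setIntegral_congr_set (image_coeffOfParts_ae_eq N),
      integral_image_eq_integral_abs_det_fderiv_smul volume hm
        (fun x _ => hasFDerivWithinAt_coeffOfParts x _) (injOn_coeffOfParts N),
      setIntegral_congr_fun hm fun x hx => abs_det_smul_integrand α hx,
      (measurePreserving_toRoots N).setIntegral_preimage_emb (measurableEmbedding_toRoots N)
        (fun z => 2 ^ N * rootIntegrand α z), integral_const_mul]
  have h2 := two_pow_mul_integral_rootBox (N := N) hα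
  -- The N! from ordering the roots cancels the N! of the pairing sum.
  rw [integral_rootBox_eq (rootIntegrand_comp_perm α) (integrableOn_rootIntegrand hα)] at h2
  have h3 : (N.factorial : ℂ) ≠ 0 := Nat.cast_ne_zero.2 (Nat.factorial_ne_zero _)
  refine mul_left_cancel₀ h3 ?_
  rw [← h2, h1]
  ring

theorem integrand_one (a : Fin (2 * N) → ℝ) : integrand N 1 a = 1 := by
  simp [integrand]

theorem volume_OmegaComplex (N : ℕ) :
    volume (OmegaComplex N) = ENNReal.ofReal (Dminus N) := by
  have hα : -(1 / 2 : ℝ) < (1 : ℂ).re := by norm_num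
  have h1 : Cminus N 1 = (Dminus N : ℂ) := by rw [Cminus_eq_cauchyForm hα, cauchyForm_one]
  have h2 := integrableOn_integrand (N := N) hα
  have h3 : integrand N 1 = fun _ => 1 := funext integrand_one
  -- Integrability of the constant 1 says that the volume is finite, so its real value determines
  -- it.
  rw [h3, integrableOn_const_iff] at h2
  rw [Cminus, h3, setIntegral_const, Complex.real_smul, mul_one] at h1
  have h4 : volume.real (OmegaComplex N) = Dminus N := by exact_mod_cast h1
  rw [← h4, ofReal_measureReal (h2.resolve_left (by simp)).ne]

end TotallyComplex
end

theorem mainTheorem4 (N : ℕ) (hN : 1 ≤ N) :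
    (∀ α : ℂ, -(1 / 2 : ℝ) < α.re →
      MeasureTheory.IntegrableOn (TotallyComplex.integrand N α) (TotallyComplex.OmegaComplex N) ∧
      TotallyComplex.Cminus N α =
        (TotallyComplex.K N : ℂ) * ((2 * N).choose N : ℂ) *
          ((4 * (N : ℂ) + 2 * α) * TotallyComplex.poch ((N : ℂ) + α + 1 / 2) N /
            TotallyComplex.poch ((N : ℂ) + α) (1 + N)) *
          ∏ k ∈ Finset.Icc 1 N,
            TotallyComplex.poch (α + (k : ℂ)) (2 * N + 1 - 2 * k) /
              TotallyComplex.poch (α - 1 / 2 + (k : ℂ)) (2 * N + 2 - 2 * k)) ∧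
    MeasureTheory.volume (TotallyComplex.OmegaComplex N) =
      ENNReal.ofReal (TotallyComplex.Dminus N) ∧
    TotallyComplex.Cminus N 1 = (TotallyComplex.Dminus N : ℂ) := by
  refine ⟨fun α hα => ⟨TotallyComplex.integrableOn_integrand hα, ?_⟩,
    TotallyComplex.volume_OmegaComplex N, ?_⟩
  · rw [TotallyComplex.Cminus_eq_cauchyForm hα, TotallyComplex.cauchyForm_eq_closedForm hN hα]
    rfl
  · rw [TotallyComplex.Cminus_eq_cauchyForm (by norm_num), TotallyComplex.cauchyForm_one]
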